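/- Let $n\ge 4$, $N=\{1,\dots,n\}$, $N_1=N\setminus\{1\}$, $A=\{ij: i,j\in N,\ i\ne j\}$ and $A_1=\{ij: i,j\in N_1,\ i\neq j\}$. For a node $i$ let $\delta^+(i)$ and $\delta^-(i)$ be the sets of arcs of $A$ leaving and entering $i$; for $S\subseteq N_1$ let $A(S)=\{ij\in A: i,j\in S\}$. Let $\mathcal C_1$ be the set of directed (simple) cycles with arcs in $A_1$, each regarded as its set of arcs (cycles with two arcs included), and $|C|$ the number of arcs of $C$. Put $$P_{\rm AP}=\Big\{x\in[0,1]^A:\ \sum_{a\in\delta^+(i)}x_a=\sum_{a\in\delta^-(i)}x_a=1\ \text{ for all } i\in N\Big\},$$ $$D=\Big\{d\in\mathbb R^{A_1}_{>0}:\ \sum_{ij\in C}d_{ij}\le 1\ \text{ for all } C\in\mathcal C_1\Big\},\qquad B=\Big\{b\in\mathbb R^{N_1}_{>0}:\ \sum_{i\in N_1}b_i=1\Big\},$$ and $V_{\rm MTZ}=\{d^k: k\in N_1\}\subset\mathbb R^{A_1}$, where $d^k_{ij}=1$ if $i=k$ and $d^k_{ij}=0$ otherwise. For $d\in\mathbb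 R^{A_1}$ and $b\in\mathbb R^{N_1}$ define - $P_{\rm MTZ}(d)$: the set of $x\in P_{\rm AP}$ for which there is $u\in\mathbb R^{N_1}$ with $u_i-u_j+d_{ij}\le 1-x_{ij}$ for all $ij\in A_1$; - $P_{\rm DL}(d)$: the set of $x\in P_{\rm AP}$ for which there is $u\in\mathbb R^{N_1}$ with $u_i-u_j+x_{ij}+(1-d_{ij}-d_{ji})x_{ji}\le 1-d_{ij}$ for all $ij\in A_1$; - $P_{\rm SCF}(b)$: the set of $x\in P_{\rm AP}$ for which there is $f\in\mathbb R^A_{\ge0}$ with $f\le x$ and $\sum_{a\in\delta^+(i)}f_a-\sum_{a\in\delta^-(i)}f_a$ equal to $1$ for $i=1$ and to $-b_i$ for $i\in N_1$. For a parameter set $\mathcal P$ let $\mathbf{Cl}(P(\mathcal P))=\bigcap_{p\in\mathcal P}P(p)$. Then: 1. For $n\ge4$, $\mathbf{Cl}(P_{\rm SCF}(B))\subseteq\mathbf{Cl}(P_{\rm DL}(D))\subseteq\mathbf{Cl}(P_{\rm DL}(V_{\rm MTZ}))\subseteq\mathbf{Cl}(P_{\rm MTZ}(D))$. 2. For $n=4$,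 these four sets are equal. 3. For $n\ge5$, for every $C\in\mathcal C_1$ with $3\le|C|\le n-2$ and every node $k$ of $C$, with predecessor $k^-$ and successor $k^+$ in $C$, there is $\hat x\in\mathbf{Cl}(P_{\rm MTZ}(D))$ with $\sum_{ij\in C}(\hat x_{ij}+\hat x_{ji})-\hat x_{k^+k}-\hat x_{kk^-}>|C|-1$. Moreover $\mathbf{Cl}(P_{\rm DL}(V_{\rm MTZ}))\subsetneq\mathbf{Cl}(P_{\rm MTZ}(D))$. 4. For $n\ge5$, for every $C\in\mathcal C_1$ with $3\le|C|\le n-2$ and every arc $kl\in C$ there is $\hat x\in\mathbf{Cl}(P_{\rm DL}(V_{\rm MTZ}))$ with $\sum_{ij\in C}(\hat x_{ij}+\hat x_{ji})-\hat x_{lk}>|C|-1$. Moreover $\mathbf{Cl}(P_{\rm DL}(D))\subsetneq\mathbf{Cl}(P_{\rm DL}(V_{\rm MTZ}))$. 5. For $n\ge5$, for every $S\subseteq N_1$ with $3\le|S|\le n-2$ there is $\hat x\in\mathbf{Cl}(P_{\rm DL}(D))$ with $\sum_{ij\in A(S)}\hat x_{ij}>|S|-1$. Moreover $\mathbf{Cl}(P_{\rm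 SCF}(B))\subsetneq\mathbf{Cl}(P_{\rm DL}(D))$. In particular, for $n\ge5$, $\mathbf{Cl}(P_{\rm SCF}(B))\subsetneq\mathbf{Cl}(P_{\rm DL}(D))\subsetneq\mathbf{Cl}(P_{\rm DL}(V_{\rm MTZ}))\subsetneq\mathbf{Cl}(P_{\rm MTZ}(D))$. -/

import Mathlib

namespace ATSP

/-- The arcs `ij`, `i ≠ j`, of the complete directed graph on the node set `V`. -/
abbrev Arc (V : Type*) := {a : V × V // a.1 ≠ a.2}

namespace Arc

/-- The node at which an arc starts. -/
abbrev tail {V : Type*} (a : Arc V) : V := a.1.1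

/-- The node at which an arc ends. -/
abbrev head {V : Type*} (a : Arc V) : V := a.1.2

/-- The reversed arc `ji` of the arc `ij`. -/
def rev {V : Type*} (a : Arc V) : Arc V := ⟨(a.head, a.tail), a.2.symm⟩

end Arc

/-- The set `N₁` of all nodes other than the special node `r`. -/
abbrev NonRoot {N : Type*} (r : N) := {i : N // i ≠ r}

/-- An arc of the complete directed graph on `N₁` (an element of `A₁`), seen as an arc on `N`. -/
def Arc.incl {N : Type*} {r : N} (a : Arc (NonRoot r)) : Arc N :=
  ⟨(a.tail.1, a.head.1), fun h => a.2 (Subtype.ext h)⟩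

section Graph

variable {V : Type*} [Fintype V] [DecidableEq V]

/-- `δ⁺(i)`: the arcs leaving the node `i`. -/
def outArcs (i : V) : Finset (Arc V) := Finset.univ.filter fun a => a.tail = i

/-- `δ⁻(i)`: the arcs entering the node `i`. -/
def inArcs (i : V) : Finset (Arc V) := Finset.univ.filter fun a => a.head = i

/-- `A(S)`: the arcs with both ends in `S`. -/
def arcsWithin (S : Finset V) : Finset (Arc V) :=
  Finset.univ.filter fun a => a.tail ∈ S ∧ a.head ∈ S

/-- A set of arcs is a (simple) directed cycle if it consists of the arcs from `i` to `σ i`,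
where `σ` is a cyclic permutation, `i` runs over the nodes moved by `σ` (the nodes of the
cycle), and `σ i` is the successor of `i` on the cycle. Cycles of length two are included;
arcs have distinct ends, so that the nodes fixed by `σ` contribute no arc. -/
def IsDirectedCycle (C : Finset (Arc V)) : Prop :=
  ∃ σ : Equiv.Perm V, σ.IsCycle ∧ C = Finset.univ.filter fun a : Arc V => a.head = σ a.tail

end Graph

section Polyhedra

variable {N : Type*} [Fintype N] [DecidableEq N]

/-- The (restricted) assignment polytope `P_AP`. -/
def assignmentPolytope (N : Type*) [Fintype N] [DecidableEq N] : Set (Arc N → ℝ) :=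
  {x | (∀ a, 0 ≤ x a ∧ x a ≤ 1) ∧
    (∀ i, ∑ a ∈ outArcs i, x a = 1) ∧ (∀ i, ∑ a ∈ inArcs i, x a = 1)}

variable (r : N)

/-- The parameter set `D` of the `d`-MTZ and `d`-DL formulations. -/
def paramD : Set (Arc (NonRoot r) → ℝ) :=
  {d | (∀ a, 0 < d a) ∧ ∀ C : Finset (Arc (NonRoot r)), IsDirectedCycle C → ∑ a ∈ C, d a ≤ 1}

/-- The parameter set `B` of the `b`-SCF formulations. -/
def paramB : Set (NonRoot r → ℝ) :=
  {b | (∀ i, 0 < b i) ∧ ∑ i, b i = 1}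

/-- The vector `d^k`, with value `1` on the arcs of `A₁` leaving `k` and `0` elsewhere. -/
def leavingVector (k : NonRoot r) : Arc (NonRoot r) → ℝ :=
  fun a => if a.tail = k then 1 else 0

/-- The set `V_MTZ = {d^k : k ∈ N₁}`. -/
def paramVMTZ : Set (Arc (NonRoot r) → ℝ) := Set.range (leavingVector r)

/-- The extended polyhedron `Q_MTZ(d)`, with elements `z = (x, u)`. -/
def extMTZ (d : Arc (NonRoot r) → ℝ) : Set ((Arc N → ℝ) × (NonRoot r → ℝ)) :=
  {z | z.1 ∈ assignmentPolytope N ∧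
    ∀ a : Arc (NonRoot r), z.2 a.tail - z.2 a.head + d a ≤ 1 - z.1 a.incl}

/-- The extended polyhedron `Q_DL(d)`, with elements `z = (x, u)`. -/
def extDL (d : Arc (NonRoot r) → ℝ) : Set ((Arc N → ℝ) × (NonRoot r → ℝ)) :=
  {z | z.1 ∈ assignmentPolytope N ∧
    ∀ a : Arc (NonRoot r),
      z.2 a.tail - z.2 a.head + z.1 a.incl + (1 - d a - d a.rev) * z.1 a.rev.incl ≤ 1 - d a}

/-- The extended polyhedron `Q_SCF(b)`, with elements `z = (x, f)`. -/
def extSCF (b : NonRoot r → ℝ) : Set ((Arc N → ℝ) × (Arc N → ℝ)) :=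
  {z | z.1 ∈ assignmentPolytope N ∧ (∀ a, 0 ≤ z.2 a) ∧
    ((∑ a ∈ outArcs r, z.2 a) - (∑ a ∈ inArcs r, z.2 a) = 1) ∧
    (∀ i : NonRoot r, (∑ a ∈ outArcs i.1, z.2 a) - (∑ a ∈ inArcs i.1, z.2 a) = -b i) ∧
    ∀ a, z.2 a ≤ z.1 a}

/-- `P_MTZ(d)`, the projection of `Q_MTZ(d)` onto the `x`-variables. -/
def projMTZ (d : Arc (NonRoot r) → ℝ) : Set (Arc N → ℝ) := Prod.fst '' extMTZ r d

/-- `P_DL(d)`, the projection of `Q_DL(d)` onto the `x`-variables. -/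
def projDL (d : Arc (NonRoot r) → ℝ) : Set (Arc N → ℝ) := Prod.fst '' extDL r d

/-- `P_SCF(b)`, the projection of `Q_SCF(b)` onto the `x`-variables. -/
def projSCF (b : NonRoot r → ℝ) : Set (Arc N → ℝ) := Prod.fst '' extSCF r b

end Polyhedra

/-- The closure `Cl(P(𝒫))` of a family of parametric formulations: the intersection of the
formulations `P p` over all parameters `p ∈ 𝒫`. -/
def Cl {ι X : Type*} (P : ι → Set X) (params : Set ι) : Set X := ⋂ p ∈ params, P p

end ATSP

/-!
By duality for difference constraints (`exists_potential_iff`), the projections of the MTZ and DL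
formulations are described by one inequality for each directed cycle (`mem_projMTZ_iff`,
`mem_projDL_iff`). These are affine in `d`, so that the closure over `D` may be taken over the
closure of `D` (`mem_Cl_projDL_iff`), which contains the vectors `d^k` and the unit vectors. For the
MTZ formulations what remains are the circuit inequalities `x(C) ≤ |C| - 1` (`mem_Cl_projMTZ_iff`).
A flow, with nearly all demand at one node of `S`, forces the subtour elimination inequality
`x(A(S)) ≤ |S| - 1` (`subtour_of_mem_Cl_projSCF`), and this inequality for the node set of a cycle
implies all DL inequalities of the cycle (`DLIneq_of_subtour`). The chain of inclusions follows.

With four nodes, the circuit inequalities for two-arc cycles, together with the degree equations,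
suffice to write down unit flows from the root to each node, and the required flow is a convex
combination of these (`Cl_projMTZ_subset_of_four`).

With at least five nodes, let `C` be a cycle on a node set `S` that misses the root `r` and another
node. Let `σ` be the cycle cover formed by `C` and a cycle through all other nodes. Exchanging the
successors of `r` and of a node `v ∈ S` in `σ` or `σ⁻¹` gives a tour that contains all arcs of `C`,
or of its reversal, except the one leaving `v` (`IsTwoCycleCover.isTour`). A convex combination of
such permutations satisfies the subtour elimination inequality for every node set other than `S`
(`subtour_mixture`), so that only cycles on `S` matter. Of these, only `C` and its reversal need
attention in the DL case: any other cycle on `S` has an arc joining nodes that are not adjacent on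
`C` (`DLIneq_mixture`). The three separating points are `2/3 σ + 1/3 τ` and `1/2 σ + 1/2 τ`, with a
tour `τ` obtained from `σ⁻¹`, and the average of `σ`, `σ⁻¹` and two tours obtained from each of
them.
-/

namespace ATSP

/-! ### Arc vectors as matrices -/

section ArcMatrix

variable {V : Type*}

open Classical in
/-- A vector indexed by the arcs, written as a square matrix with zero diagonal. -/
noncomputable def mat (f : Arc V → ℝ) (i j : V) : ℝ := if h : i ≠ j then f ⟨(i, j), h⟩ else 0

theorem mat_of_ne (f : Arc V → ℝ) {i j : V} (h : i ≠ j) : mat f i j = f ⟨(i, j), h⟩ := by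
  simp [mat, h]

@[simp] theorem mat_self (f : Arc V → ℝ) (i : V) : mat f i i = 0 := by simp [mat]

@[simp] theorem mat_tail_head (f : Arc V → ℝ) (a : Arc V) : mat f a.tail a.head = f a :=
  mat_of_ne f a.2

@[simp] theorem mat_head_tail (f : Arc V → ℝ) (a : Arc V) : mat f a.head a.tail = f a.rev :=
  mat_of_ne f a.2.symm

theorem mat_nonneg {f : Arc V → ℝ} (hf : ∀ a, 0 ≤ f a) (i j : V) : 0 ≤ mat f i j := by
  unfold mat; split_ifs <;> simp [hf]

theorem mat_add_smul (s t : ℝ) (d e : Arc V → ℝ) (i j : V) :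
    mat (fun a => s * d a + t * e a) i j = s * mat d i j + t * mat e i j := by
  by_cases h : i = j
  · simp [h]
  · simp [mat_of_ne _ h]

theorem mat_const_le (t : ℝ) (ht : 0 ≤ t) (i j : V) : mat (fun _ => t) i j ≤ t := by
  unfold mat; split_ifs <;> simp [ht]

theorem mat_incl {N : Type*} {r : N} (x : Arc N → ℝ) (i j : NonRoot r) :
    mat (fun a : Arc (NonRoot r) => x a.incl) i j = mat x i.1 j.1 := by
  by_cases h : i = j
  · simp [h]
  · rw [mat_of_ne _ h, mat_of_ne _ (fun h' => h (Subtype.ext h'))]; rfl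

variable [Fintype V] [DecidableEq V]

theorem sum_arc (g : Arc V → ℝ) : ∑ a, g a = ∑ i, ∑ j, mat g i j := by
  rw [← Fintype.sum_prod_type' (fun i j => mat g i j)]
  have h : ∑ p : V × V, mat g p.1 p.2
      = ∑ p ∈ Finset.univ.filter (fun p : V × V => p.1 ≠ p.2), mat g p.1 p.2 := by
    symm
    apply Finset.sum_subset (Finset.subset_univ _)
    intro p _ hp
    have : p.1 = p.2 := by simpa using hp
    simp [this]
  rw [h, Finset.sum_subtype (p := fun p : V × V => p.1 ≠ p.2) _ (by simp)]
  exact Finset.sum_congr rfl fun a _ => (mat_tail_head g a).symm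

theorem sum_arc_filter (p : V → V → Prop) [DecidableRel p] (g : Arc V → ℝ) :
    ∑ a ∈ Finset.univ.filter (fun a : Arc V => p a.tail a.head), g a
      = ∑ i, ∑ j, if p i j then mat g i j else 0 := by
  rw [Finset.sum_filter, sum_arc]
  refine Finset.sum_congr rfl fun i _ => Finset.sum_congr rfl fun j _ => ?_
  by_cases h : i = j
  · simp [h]
  · simp [mat_of_ne _ h]

theorem sum_outArcs (g : Arc V → ℝ) (i : V) : ∑ a ∈ outArcs i, g a = ∑ j, mat g i j := by
  unfold outArcs
  rw [sum_arc_filter (fun k _ => k = i), Finset.sum_eq_single i] <;> simp +contextual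

theorem sum_inArcs (g : Arc V → ℝ) (j : V) : ∑ a ∈ inArcs j, g a = ∑ i, mat g i j := by
  unfold inArcs
  rw [sum_arc_filter (fun _ k => k = j)]
  simp

theorem sum_arcsWithin (g : Arc V → ℝ) (S : Finset V) :
    ∑ a ∈ arcsWithin S, g a = ∑ i ∈ S, ∑ j ∈ S, mat g i j := by
  unfold arcsWithin
  rw [sum_arc_filter (fun i j => i ∈ S ∧ j ∈ S)]
  simp [ite_and, Finset.sum_ite_irrel]

/-- The set of arcs from `i` to `ρ i`, where `i` runs over the nodes moved by `ρ`. -/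
def permArcs (ρ : Equiv.Perm V) : Finset (Arc V) :=
  Finset.univ.filter fun a : Arc V => a.head = ρ a.tail

theorem sum_permArcs (ρ : Equiv.Perm V) (g : Arc V → ℝ) :
    ∑ a ∈ permArcs ρ, g a = ∑ i ∈ ρ.support, mat g i (ρ i) := by
  unfold permArcs
  rw [sum_arc_filter (fun i j => j = ρ i)]
  simp only [Finset.sum_ite_eq', Finset.mem_univ, if_true]
  symm
  apply Finset.sum_subset (Finset.subset_univ _)
  intro i _ hi
  simp [Equiv.Perm.notMem_support.1 hi]

theorem card_permArcs (ρ : Equiv.Perm V) : (permArcs ρ).card = ρ.support.card := by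
  have h := sum_permArcs ρ (fun _ => 1)
  rw [Finset.sum_congr rfl fun i hi =>
    mat_of_ne (fun _ => (1 : ℝ)) (Equiv.Perm.mem_support.1 hi).symm] at h
  exact_mod_cast (by simpa using h : ((permArcs ρ).card : ℝ) = ρ.support.card)

end ArcMatrix

/-! ### Feasibility of difference constraints -/

section Potentials

variable {V : Type*}

/-- The total cost of the steps between consecutive entries of a list. -/
def walkCost (c : V → V → ℝ) (l : List V) : ℝ := (l.zipWith c l.tail).sum

theorem walkCost_cons_cons (c : V → V → ℝ) (i j : V) (l : List V) :
    walkCost c (i :: j :: l) = c i j + walkCost c (j :: l) := by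
  simp [walkCost]

theorem walkCost_append (c : V → V → ℝ) (l₁ l₂ : List V) (i : V) :
    walkCost c (l₁ ++ i :: l₂) = walkCost c (l₁ ++ [i]) + walkCost c (i :: l₂) := by
  induction l₁ with
  | nil => simp [walkCost]
  | cons a t ih =>
    cases t with
    | nil => simp [walkCost]
    | cons b t =>
      simp only [List.cons_append, walkCost_cons_cons] at ih ⊢
      rw [ih]; ring

variable [Fintype V] [DecidableEq V]

/-- The cost of a closed walk through distinct nodes is a sum over the corresponding cyclic
permutation. -/
theorem sum_support_formPerm (c : V → V → ℝ) (i j : V) (l : List V) (hl : (i :: j :: l).Nodup) :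
    ∑ k ∈ (i :: j :: l).formPerm.support, c k ((i :: j :: l).formPerm k)
      = walkCost c (i :: j :: l ++ [i]) := by
  rw [List.support_formPerm_of_nodup _ hl (by simp), List.sum_toFinset _ hl]
  have hrot : (i :: j :: l).map (i :: j :: l).formPerm = j :: l ++ [i] := by
    have : (i :: j :: l).map (i :: j :: l).formPerm = (i :: j :: l).rotate 1 := by
      apply List.ext_getElem (by simp)
      intro k h₁ h₂
      rw [List.getElem_map, List.formPerm_apply_getElem _ hl, List.getElem_rotate]
    rw [this]; simp
  have hmap : (i :: j :: l).map (fun k => c k ((i :: j :: l).formPerm k))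
      = (i :: j :: l).zipWith c ((i :: j :: l).map (i :: j :: l).formPerm) := by
    rw [List.zipWith_map_right, List.zipWith_self]
  rw [hmap, hrot, walkCost]
  congr 1
  have : ∀ (s : List V) (t : List V), s.length = t.length →
      (s ++ [i]).zipWith c t = s.zipWith c t := by
    intro s t hst
    have := List.zipWith_append (f := c) (l₁ := s) (l₁' := [i]) (l₂ := t) (l₂' := []) hst
    simpa using this
  exact (this (i :: j :: l) (j :: l ++ [i]) (by simp)).symm

/-- A system of difference constraints is feasible if and only if no simple cycle has negative
cost. The potential of `i` is the least cost of a simple path that starts at `i`. -/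
theorem exists_potential_iff (c : V → V → ℝ) :
    (∃ u : V → ℝ, ∀ i j, i ≠ j → u i - u j ≤ c i j) ↔
      ∀ ρ : Equiv.Perm V, ρ.IsCycle → 0 ≤ ∑ i ∈ ρ.support, c i (ρ i) := by
  constructor
  · rintro ⟨u, hu⟩ ρ -
    have h0 : ∑ i ∈ ρ.support, (u i - u (ρ i)) = 0 := by
      rw [Finset.sum_subset (Finset.subset_univ ρ.support), Finset.sum_sub_distrib,
        Equiv.sum_comp ρ u, sub_self]
      intro i _ hi
      simp [Equiv.Perm.notMem_support.1 hi]
    rw [← h0]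
    exact Finset.sum_le_sum fun i hi => hu _ _ (Equiv.Perm.mem_support.1 hi).symm
  · intro hc
    let P : V → Finset {l : List V // l.Nodup} := fun i =>
      Finset.univ.filter fun l => l.1.head? = some i
    have hP : ∀ i, (P i).Nonempty := fun i => ⟨⟨[i], by simp⟩, by simp [P]⟩
    let u : V → ℝ := fun i => (P i).inf' (hP i) fun l => walkCost c l.1
    have hu : ∀ i l, (i :: l).Nodup → u i ≤ walkCost c (i :: l) := fun i l hl =>
      Finset.inf'_le (fun l : {l : List V // l.Nodup} => walkCost c l.1)
        (b := ⟨i :: l, hl⟩) (by simp [P])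
    refine ⟨u, fun i j hij => ?_⟩
    obtain ⟨⟨l, hl⟩, hlP, hlu⟩ :=
      Finset.exists_mem_eq_inf' (hP j) fun l : {l : List V // l.Nodup} => walkCost c l.1
    have hlu : u j = walkCost c l := hlu
    obtain ⟨t, rfl⟩ : ∃ t, l = j :: t := by
      simp only [P, Finset.mem_filter, Finset.mem_univ, true_and] at hlP
      cases l with
      | nil => simp at hlP
      | cons a t => exact ⟨t, by simpa using hlP⟩
    by_cases hi : i ∈ j :: t
    · -- the optimal path from `j` passes through `i`: its first part closes a cycle with `ij`
      have hit : i ∈ t := by simpa [hij] using hi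
      obtain ⟨s, s', rfl⟩ := List.append_of_mem hit
      have hsplit := walkCost_append c (j :: s) s' i
      have hnd : (i :: j :: s).Nodup ∧ (i :: s').Nodup := by
        simp only [List.nodup_cons, List.nodup_append, List.mem_append, List.mem_cons] at hl ⊢
        grind
      have hcyc := hc _ (List.isCycle_formPerm hnd.1 (by simp))
      rw [sum_support_formPerm c i j s hnd.1] at hcyc
      have h2 := hu i s' hnd.2
      simp only [List.cons_append] at hsplit hcyc
      rw [walkCost_cons_cons] at hcyc
      rw [hlu, hsplit]
      linarith
    · have := hu i (j :: t) (List.nodup_cons.2 ⟨hi, hl⟩)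
      rw [walkCost_cons_cons] at this
      rw [hlu]; linarith

end Potentials

/-! ### Cycle descriptions of the MTZ and DL formulations -/

section SubMatrix

variable {N : Type*} {r : N}

/-- The matrix of `x`, restricted to the nodes other than `r`. -/
noncomputable def subMat (r : N) (x : Arc N → ℝ) (i j : NonRoot r) : ℝ := mat x i.1 j.1

theorem subMat_incl (x : Arc N → ℝ) (a : Arc (NonRoot r)) :
    subMat r x a.tail a.head = x a.incl := by
  rw [subMat, ← mat_incl, mat_tail_head]

theorem subMat_rev_incl (x : Arc N → ℝ) (a : Arc (NonRoot r)) :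
    subMat r x a.head a.tail = x a.rev.incl := subMat_incl x a.rev

end SubMatrix

section Projections

variable {V : Type*} [Fintype V] [DecidableEq V]

/-- The inequality that the cycle of `ρ` contributes to the projection of the `d`-DL formulation;
`X` and `D` are the matrices of `x` and `d`. -/
def DLIneq (X D : V → V → ℝ) (ρ : Equiv.Perm V) : Prop :=
  ∑ i ∈ ρ.support, (X i (ρ i) + X (ρ i) i) + ∑ i ∈ ρ.support, D i (ρ i)
    - ∑ i ∈ ρ.support, (D i (ρ i) + D (ρ i) i) * X (ρ i) i ≤ ρ.support.card

variable {N : Type*} [Fintype N] [DecidableEq N] {r : N}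

theorem subMat_nonneg {x : Arc N → ℝ} (hx : x ∈ assignmentPolytope N) (i j : NonRoot r) :
    0 ≤ subMat r x i j := mat_nonneg (fun a => (hx.1 a).1) _ _

theorem row_sum {x : Arc N → ℝ} (hx : x ∈ assignmentPolytope N) (i : N) :
    ∑ j, mat x i j = 1 := by
  rw [← sum_outArcs]; exact hx.2.1 i

theorem col_sum {x : Arc N → ℝ} (hx : x ∈ assignmentPolytope N) (j : N) :
    ∑ i, mat x i j = 1 := by
  rw [← sum_inArcs]; exact hx.2.2 j

theorem mem_projMTZ_iff (d : Arc (NonRoot r) → ℝ) (x : Arc N → ℝ) :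
    x ∈ projMTZ r d ↔ x ∈ assignmentPolytope N ∧ ∀ ρ : Equiv.Perm (NonRoot r), ρ.IsCycle →
      ∑ i ∈ ρ.support, subMat r x i (ρ i) + ∑ i ∈ ρ.support, mat d i (ρ i)
        ≤ ρ.support.card := by
  have h := exists_potential_iff fun i j => 1 - subMat r x i j - mat d i j
  have h₁ : x ∈ projMTZ r d ↔ x ∈ assignmentPolytope N ∧
      ∃ u : NonRoot r → ℝ, ∀ i j, i ≠ j → u i - u j ≤ 1 - subMat r x i j - mat d i j := by
    constructor
    · rintro ⟨⟨x, u⟩, ⟨hx, hu⟩, rfl⟩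
      refine ⟨hx, u, fun i j hij => ?_⟩
      have := hu ⟨(i, j), hij⟩
      rw [← subMat_incl (x, u).1, ← mat_tail_head d] at this
      dsimp only at this ⊢
      linarith
    · rintro ⟨hx, u, hu⟩
      refine ⟨⟨x, u⟩, ⟨hx, fun a => ?_⟩, rfl⟩
      have := hu a.tail a.head a.2
      rw [subMat_incl, mat_tail_head] at this
      dsimp only at this ⊢
      linarith
  rw [h₁, h]
  simp only [Finset.sum_sub_distrib, Finset.sum_const, nsmul_eq_mul, mul_one]
  refine and_congr_right fun _ => forall_congr' fun ρ => forall_congr' fun _ => ?_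
  constructor <;> intro h <;> linarith

theorem mem_projDL_iff (d : Arc (NonRoot r) → ℝ) (x : Arc N → ℝ) :
    x ∈ projDL r d ↔ x ∈ assignmentPolytope N ∧
      ∀ ρ : Equiv.Perm (NonRoot r), ρ.IsCycle → DLIneq (subMat r x) (mat d) ρ := by
  have h := exists_potential_iff fun i j =>
    1 - mat d i j - subMat r x i j - (1 - mat d i j - mat d j i) * subMat r x j i
  have h₁ : x ∈ projDL r d ↔ x ∈ assignmentPolytope N ∧
      ∃ u : NonRoot r → ℝ, ∀ i j, i ≠ j → u i - u j ≤
        1 - mat d i j - subMat r x i j - (1 - mat d i j - mat d j i) * subMat r x j i := by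
    constructor
    · rintro ⟨⟨x, u⟩, ⟨hx, hu⟩, rfl⟩
      refine ⟨hx, u, fun i j hij => ?_⟩
      have := hu ⟨(i, j), hij⟩
      rw [← subMat_incl (x, u).1, ← subMat_rev_incl (x, u).1, ← mat_tail_head d,
        ← mat_head_tail d] at this
      dsimp only at this ⊢
      linarith
    · rintro ⟨hx, u, hu⟩
      refine ⟨⟨x, u⟩, ⟨hx, fun a => ?_⟩, rfl⟩
      have := hu a.tail a.head a.2
      rw [subMat_incl, subMat_rev_incl, mat_tail_head, mat_head_tail] at this
      dsimp only at this ⊢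
      linarith
  rw [h₁, h]
  refine and_congr_right fun _ => forall_congr' fun ρ => forall_congr' fun _ => ?_
  have : ∑ i ∈ ρ.support, (1 - mat d i (ρ i) - subMat r x i (ρ i)
        - (1 - mat d i (ρ i) - mat d (ρ i) i) * subMat r x (ρ i) i)
      = ρ.support.card - (∑ i ∈ ρ.support, (subMat r x i (ρ i) + subMat r x (ρ i) i)
        + ∑ i ∈ ρ.support, mat d i (ρ i)
        - ∑ i ∈ ρ.support, (mat d i (ρ i) + mat d (ρ i) i) * subMat r x (ρ i) i) := by
    rw [← Finset.sum_add_distrib, ← Finset.sum_sub_distrib, Finset.card_eq_sum_ones,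
      Nat.cast_sum, ← Finset.sum_sub_distrib]
    refine Finset.sum_congr rfl fun i _ => ?_
    push_cast; ring
  rw [this, DLIneq, sub_nonneg]

end Projections

/-! ### Closures over the parameter sets -/

section Parameters

variable {V : Type*} [Fintype V] [DecidableEq V]

/-- The closure of the parameter set `D`: nonnegative vectors of weight at most one on every
directed cycle. -/
def closedParamD (V : Type*) [Fintype V] [DecidableEq V] : Set (Arc V → ℝ) :=
  {d | (∀ a, 0 ≤ d a) ∧ ∀ ρ : Equiv.Perm V, ρ.IsCycle → ∑ i ∈ ρ.support, mat d i (ρ i) ≤ 1}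

theorem const_mem_closedParamD {t : ℝ} (ht : 0 ≤ t) (ht' : Fintype.card V * t ≤ 1) :
    (fun _ => t) ∈ closedParamD V := by
  refine ⟨fun _ => ht, fun ρ _ => ?_⟩
  calc ∑ i ∈ ρ.support, mat (fun _ => t) i (ρ i) ≤ ∑ i ∈ ρ.support, t :=
        Finset.sum_le_sum fun i _ => mat_const_le t ht _ _
    _ = ρ.support.card * t := by simp
    _ ≤ Fintype.card V * t := by
        gcongr; exact_mod_cast Finset.card_le_univ _
    _ ≤ 1 := ht'

/-- A vector that is supported on the arcs leaving one node, with values at most one, has weight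
at most one on every cycle, because a cycle leaves each node at most once. -/
theorem mem_closedParamD_of_leaving {d : Arc V → ℝ} (k : V) (h0 : ∀ a, 0 ≤ d a)
    (h1 : ∀ a, d a ≤ 1) (hk : ∀ a, a.tail ≠ k → d a = 0) : d ∈ closedParamD V := by
  refine ⟨h0, fun ρ _ => ?_⟩
  calc ∑ i ∈ ρ.support, mat d i (ρ i) ≤ ∑ i ∈ ρ.support, if i = k then 1 else 0 := by
        refine Finset.sum_le_sum fun i hi => ?_
        rw [mat_of_ne _ (Equiv.Perm.mem_support.1 hi).symm]
        split_ifs with h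
        · exact h1 _
        · exact (hk _ h).le
    _ ≤ 1 := by
        rw [Finset.sum_ite_eq']; split_ifs <;> simp

variable {N : Type*} [Fintype N] [DecidableEq N] {r : N}

theorem leavingVector_mem_closedParamD (k : NonRoot r) :
    leavingVector r k ∈ closedParamD (NonRoot r) := by
  refine mem_closedParamD_of_leaving k ?_ ?_ ?_ <;> intro a <;> unfold leavingVector
  · split_ifs <;> simp
  · split_ifs <;> simp
  · intro h; simp [h]

theorem single_mem_closedParamD (q : Arc V) :
    (fun a => if a = q then (1 : ℝ) else 0) ∈ closedParamD V := by
  refine mem_closedParamD_of_leaving q.tail ?_ ?_ ?_ <;> intro a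
  · split_ifs <;> simp
  · split_ifs <;> simp
  · rintro h; rw [if_neg]; rintro rfl; exact h rfl

theorem mem_paramD_iff (d : Arc (NonRoot r) → ℝ) :
    d ∈ paramD r ↔ (∀ a, 0 < d a) ∧ d ∈ closedParamD (NonRoot r) := by
  constructor
  · rintro ⟨h1, h2⟩
    refine ⟨h1, fun a => (h1 a).le, fun ρ hρ => ?_⟩
    rw [← sum_permArcs]
    exact h2 _ ⟨ρ, hρ, rfl⟩
  · rintro ⟨h1, -, h2⟩
    refine ⟨h1, ?_⟩
    rintro C ⟨ρ, hρ, rfl⟩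
    exact (sum_permArcs ρ d).trans_le (h2 ρ hρ)

/-- Every point of `closedParamD` is the limit, along a segment, of points of `D`. -/
theorem exists_segment_paramD {d : Arc (NonRoot r) → ℝ} (hd : d ∈ closedParamD (NonRoot r)) :
    ∃ e : Arc (NonRoot r) → ℝ, ∀ t : ℝ, 0 < t → t < 1 →
      (fun a => (1 - t) * d a + t * e a) ∈ paramD r := by
  have hpos : (0 : ℝ) < (Fintype.card (NonRoot r) + 1 : ℝ)⁻¹ := by positivity
  have he := const_mem_closedParamD (V := NonRoot r) hpos.le (by
    rw [← div_eq_mul_inv, div_le_one (by positivity)]; linarith)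
  refine ⟨fun _ => (Fintype.card (NonRoot r) + 1 : ℝ)⁻¹, fun t ht ht' => ?_⟩
  rw [mem_paramD_iff]
  refine ⟨fun a => ?_, fun a => ?_, fun ρ hρ => ?_⟩
  · have := mul_nonneg (sub_nonneg.2 ht'.le) (hd.1 a); positivity
  · have := mul_nonneg (sub_nonneg.2 ht'.le) (hd.1 a); positivity
  · simp only [mat_add_smul, Finset.sum_add_distrib, ← Finset.mul_sum]
    have h1 := hd.2 ρ hρ
    have h2 := he.2 ρ hρ
    nlinarith

/-- A bound for an affine function of `t` on the open interval `(0, 1)` holds at `0` too. -/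
theorem le_of_forall_segment {a b c : ℝ} (h : ∀ t : ℝ, 0 < t → t < 1 → (1 - t) * a + t * b ≤ c) :
    a ≤ c := by
  by_contra! hlt
  have key : 0 < |b - a| + (a - c) := by positivity
  set t := (a - c) / (2 * (|b - a| + (a - c))) with ht
  have h0 : 0 < t := by rw [ht]; apply div_pos <;> linarith
  have hm : t * (2 * (|b - a| + (a - c))) = a - c := div_mul_cancel₀ _ (by linarith)
  have h1 : t < 1 := by
    rw [ht, div_lt_one (by linarith)]; linarith [abs_nonneg (b - a)]
  have := h t h0 h1
  have h3 : -(t * |b - a|) ≤ t * (b - a) := by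
    have := mul_le_mul_of_nonneg_left (neg_abs_le (b - a)) h0.le
    linarith
  have h4 : 0 < t * (a - c) := mul_pos h0 (by linarith)
  nlinarith [mul_nonneg h0.le (abs_nonneg (b - a))]

theorem mem_Cl {ι X : Type*} {P : ι → Set X} {s : Set ι} {x : X} :
    x ∈ Cl P s ↔ ∀ p ∈ s, x ∈ P p := by simp [Cl]

theorem paramD_nonempty : (paramD r).Nonempty := by
  obtain ⟨e, he⟩ := exists_segment_paramD (r := r) (d := fun _ => 0)
    (const_mem_closedParamD le_rfl (by simp))
  exact ⟨_, he (1 / 2) (by norm_num) (by norm_num)⟩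

theorem mem_Cl_projDL_iff (x : Arc N → ℝ) :
    x ∈ Cl (projDL r) (paramD r) ↔ x ∈ assignmentPolytope N ∧
      ∀ ρ : Equiv.Perm (NonRoot r), ρ.IsCycle → ∀ d ∈ closedParamD (NonRoot r),
        DLIneq (subMat r x) (mat d) ρ := by
  simp only [mem_Cl, mem_projDL_iff]
  constructor
  · intro h
    obtain ⟨d₀, hd₀⟩ := paramD_nonempty (r := r)
    refine ⟨(h d₀ hd₀).1, fun ρ hρ d hd => ?_⟩
    obtain ⟨e, he⟩ := exists_segment_paramD hd
    set X := subMat r x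
    have key : ∀ t : ℝ, 0 < t → t < 1 →
        (1 - t) * (∑ i ∈ ρ.support, (X i (ρ i) + X (ρ i) i) + ∑ i ∈ ρ.support, mat d i (ρ i)
          - ∑ i ∈ ρ.support, (mat d i (ρ i) + mat d (ρ i) i) * X (ρ i) i)
        + t * (∑ i ∈ ρ.support, (X i (ρ i) + X (ρ i) i) + ∑ i ∈ ρ.support, mat e i (ρ i)
          - ∑ i ∈ ρ.support, (mat e i (ρ i) + mat e (ρ i) i) * X (ρ i) i)
        ≤ ρ.support.card := by
      intro t ht ht'
      have := (h _ (he t ht ht')).2 ρ hρ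
      unfold DLIneq at this
      refine le_of_eq_of_le ?_ this
      simp only [mat_add_smul, ← Finset.sum_add_distrib, ← Finset.sum_sub_distrib,
        Finset.mul_sum]
      exact Finset.sum_congr rfl fun i _ => by ring
    exact le_of_forall_segment key
  · rintro ⟨hx, h⟩ d hd
    exact ⟨hx, fun ρ hρ => h ρ hρ d ((mem_paramD_iff d).1 hd).2⟩

theorem mem_Cl_projDL_leaving_iff [Nonempty (NonRoot r)] (x : Arc N → ℝ) :
    x ∈ Cl (projDL r) (paramVMTZ r) ↔ x ∈ assignmentPolytope N ∧
      ∀ ρ : Equiv.Perm (NonRoot r), ρ.IsCycle → ∀ k,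
        DLIneq (subMat r x) (mat (leavingVector r k)) ρ := by
  simp only [mem_Cl, mem_projDL_iff, paramVMTZ, Set.forall_mem_range]
  constructor
  · intro h
    exact ⟨(h (Classical.arbitrary _)).1, fun ρ hρ k => (h k).2 ρ hρ⟩
  · rintro ⟨hx, h⟩ k
    exact ⟨hx, fun ρ hρ => h ρ hρ k⟩

/-- On the closure of the MTZ formulations, the optimal choice of `d` on a cycle has weight one,
which leaves the circuit inequalities. -/
theorem mem_Cl_projMTZ_iff (x : Arc N → ℝ) :
    x ∈ Cl (projMTZ r) (paramD r) ↔ x ∈ assignmentPolytope N ∧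
      ∀ ρ : Equiv.Perm (NonRoot r), ρ.IsCycle →
        ∑ i ∈ ρ.support, subMat r x i (ρ i) ≤ ρ.support.card - 1 := by
  simp only [mem_Cl, mem_projMTZ_iff]
  constructor
  · intro h
    obtain ⟨d₀, hd₀⟩ := paramD_nonempty (r := r)
    refine ⟨(h d₀ hd₀).1, fun ρ hρ => ?_⟩
    obtain ⟨k, hk⟩ := hρ.nonempty_support
    obtain ⟨e, he⟩ := exists_segment_paramD (leavingVector_mem_closedParamD k)
    have hone : ∑ i ∈ ρ.support, mat (leavingVector r k) i (ρ i) = 1 := by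
      rw [Finset.sum_eq_single_of_mem k hk]
      · rw [mat_of_ne _ (Equiv.Perm.mem_support.1 hk).symm]; simp [leavingVector]
      · intro i hi hik
        rw [mat_of_ne _ (Equiv.Perm.mem_support.1 hi).symm]; simp [leavingVector, hik]
    have key : ∀ t : ℝ, 0 < t → t < 1 →
        (1 - t) * 1 + t * ∑ i ∈ ρ.support, mat e i (ρ i)
          ≤ ρ.support.card - ∑ i ∈ ρ.support, subMat r x i (ρ i) := by
      intro t ht ht'
      have := (h _ (he t ht ht')).2 ρ hρ
      simp only [mat_add_smul, Finset.sum_add_distrib, ← Finset.mul_sum, hone] at this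
      linarith
    linarith [le_of_forall_segment key]
  · rintro ⟨hx, h⟩ d hd
    refine ⟨hx, fun ρ hρ => ?_⟩
    linarith [h ρ hρ, ((mem_paramD_iff d).1 hd).2.2 ρ hρ]

end Parameters

/-! ### The inclusions between the closures -/

theorem mat_leavingVector {N : Type*} [DecidableEq N] {r : N} (k : NonRoot r) {i j : NonRoot r}
    (h : i ≠ j) :
    mat (leavingVector r k) i j = if i = k then 1 else 0 := by
  rw [mat_of_ne _ h]; rfl

section CycleInequalities

variable {V : Type*} [Fintype V] [DecidableEq V]

theorem apply_apply_ne {ρ : Equiv.Perm V} (hρ : ρ.IsCycle) (h3 : 3 ≤ ρ.support.card) {i : V}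
    (hi : i ∈ ρ.support) : ρ (ρ i) ≠ i := by
  intro h
  have h2 : ρ ^ 2 = 1 :=
    hρ.pow_eq_one_iff.2 ⟨i, Equiv.Perm.mem_support.1 hi, by rw [pow_two]; exact h⟩
  have := orderOf_le_of_pow_eq_one (by norm_num) h2
  rw [hρ.orderOf] at this
  omega

theorem inv_mem_support {ρ : Equiv.Perm V} {i : V} (hi : i ∈ ρ.support) :
    ρ⁻¹ i ∈ ρ.support := by
  rw [← Equiv.Perm.apply_mem_support]; simpa using hi

theorem sum_support_apply (ρ : Equiv.Perm V) (f : V → V → ℝ) :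
    ∑ i ∈ ρ.support, f (ρ i) i = ∑ i ∈ ρ.support, f i (ρ⁻¹ i) := by
  refine Finset.sum_bij (fun i _ => ρ i) (fun i hi => Equiv.Perm.apply_mem_support.2 hi)
    (fun _ _ _ _ h => ρ.injective h)
    (fun j hj => ⟨ρ⁻¹ j, inv_mem_support hj, by simp⟩) (fun i _ => by simp)

/-- The arcs of a cycle of length at least three and their reversals are distinct arcs between
nodes of the cycle. -/
theorem sum_cycle_le_within {ρ : Equiv.Perm V} (hρ : ρ.IsCycle) (h3 : 3 ≤ ρ.support.card)
    {X : V → V → ℝ} (hX : ∀ i j, 0 ≤ X i j) :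
    ∑ i ∈ ρ.support, (X i (ρ i) + X (ρ i) i) ≤ ∑ i ∈ ρ.support, ∑ j ∈ ρ.support, X i j := by
  rw [Finset.sum_add_distrib, sum_support_apply ρ X, ← Finset.sum_add_distrib]
  refine Finset.sum_le_sum fun i hi => ?_
  have hne : ρ i ≠ ρ⁻¹ i := by
    intro h
    exact apply_apply_ne hρ h3 hi (by rw [h]; simp)
  rw [← Finset.sum_pair hne]
  refine Finset.sum_le_sum_of_subset_of_nonneg ?_ fun _ _ _ => hX _ _
  intro j hj
  rcases Finset.mem_insert.1 hj with rfl | hj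
  · exact Equiv.Perm.apply_mem_support.2 hi
  · rw [Finset.mem_singleton.1 hj]; exact inv_mem_support hi

theorem DLIneq_of_sum_le {X : V → V → ℝ} {d : Arc V → ℝ} {ρ : Equiv.Perm V} (hρ : ρ.IsCycle)
    (hX : ∀ i j, 0 ≤ X i j) (hd : d ∈ closedParamD V)
    (h : ∑ i ∈ ρ.support, (X i (ρ i) + X (ρ i) i) ≤ ρ.support.card - 1) :
    DLIneq X (mat d) ρ := by
  have h1 := hd.2 ρ hρ
  have h2 : 0 ≤ ∑ i ∈ ρ.support, (mat d i (ρ i) + mat d (ρ i) i) * X (ρ i) i :=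
    Finset.sum_nonneg fun i _ =>
      mul_nonneg (add_nonneg (mat_nonneg hd.1 _ _) (mat_nonneg hd.1 _ _)) (hX _ _)
  unfold DLIneq
  linarith

/-- The subtour elimination inequality for the nodes of a cycle implies the inequalities that
this cycle contributes to all `d`-DL formulations. -/
theorem DLIneq_of_subtour {X : V → V → ℝ} {d : Arc V → ℝ} {ρ : Equiv.Perm V} (hρ : ρ.IsCycle)
    (hX : ∀ i j, 0 ≤ X i j) (hX0 : ∀ i, X i i = 0) (hd : d ∈ closedParamD V)
    (h : ∑ i ∈ ρ.support, ∑ j ∈ ρ.support, X i j ≤ ρ.support.card - 1) :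
    DLIneq X (mat d) ρ := by
  rcases hρ.two_le_card_support.eq_or_lt with h2 | h3
  · obtain ⟨a, b, hab, rfl⟩ := Equiv.Perm.card_support_eq_two.1 h2.symm
    have hd2 := hd.2 _ hρ
    unfold DLIneq
    rw [Equiv.Perm.support_swap hab] at h hd2 ⊢
    simp only [Finset.sum_pair hab, Equiv.swap_apply_left, Equiv.swap_apply_right, hX0,
      Finset.card_pair hab] at h hd2 ⊢
    push_cast at h ⊢
    nlinarith
  · exact DLIneq_of_sum_le hρ hX hd ((sum_cycle_le_within hρ h3 hX).trans h)

variable {N : Type*} [Fintype N] [DecidableEq N] {r : N}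

theorem sum_leavingVector {ρ : Equiv.Perm (NonRoot r)} (k : NonRoot r) :
    ∑ i ∈ ρ.support, mat (leavingVector r k) i (ρ i) = if k ∈ ρ.support then 1 else 0 := by
  rw [← Finset.sum_ite_eq' ρ.support k (fun _ => (1 : ℝ))]
  exact Finset.sum_congr rfl fun i hi =>
    mat_leavingVector k (Equiv.Perm.mem_support.1 hi).symm

theorem circuit_of_DLIneq_leavingVector {X : NonRoot r → NonRoot r → ℝ}
    (hX : ∀ i j, 0 ≤ X i j) {ρ : Equiv.Perm (NonRoot r)} {k : NonRoot r} (hk : k ∈ ρ.support)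
    (h : DLIneq X (mat (leavingVector r k)) ρ) :
    ∑ i ∈ ρ.support, X i (ρ i) ≤ ρ.support.card - 1 := by
  unfold DLIneq at h
  rw [sum_leavingVector, if_pos hk, Finset.sum_add_distrib] at h
  have : ∑ i ∈ ρ.support, (mat (leavingVector r k) i (ρ i) + mat (leavingVector r k) (ρ i) i)
      * X (ρ i) i ≤ ∑ i ∈ ρ.support, X (ρ i) i := by
    refine Finset.sum_le_sum fun i hi => mul_le_of_le_one_left (hX _ _) ?_
    have hne := Equiv.Perm.mem_support.1 hi
    rw [mat_leavingVector k hne.symm, mat_leavingVector k hne]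
    split_ifs with h1 h2
    · exact absurd (h2.trans h1.symm) hne
    all_goals norm_num
  linarith

theorem Cl_projDL_leaving_subset [Nonempty (NonRoot r)] :
    Cl (projDL r) (paramVMTZ r) ⊆ Cl (projMTZ r) (paramD r) := by
  intro x hx
  rw [mem_Cl_projDL_leaving_iff] at hx
  rw [mem_Cl_projMTZ_iff]
  refine ⟨hx.1, fun ρ hρ => ?_⟩
  obtain ⟨k, hk⟩ := hρ.nonempty_support
  exact circuit_of_DLIneq_leavingVector (subMat_nonneg hx.1) hk (hx.2 ρ hρ k)

theorem Cl_projDL_subset [Nonempty (NonRoot r)] :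
    Cl (projDL r) (paramD r) ⊆ Cl (projDL r) (paramVMTZ r) := by
  intro x hx
  rw [mem_Cl_projDL_iff] at hx
  rw [mem_Cl_projDL_leaving_iff]
  exact ⟨hx.1, fun ρ hρ k => hx.2 ρ hρ _ (leavingVector_mem_closedParamD k)⟩

/-- The flow into a node set `S` is at most the value of `x` on the cut. -/
theorem sum_within_le_of_mem_projSCF {b : NonRoot r → ℝ} {x : Arc N → ℝ} (hx : x ∈ projSCF r b)
    (S : Finset (NonRoot r)) :
    ∑ i ∈ S, ∑ j ∈ S, subMat r x i j ≤ S.card - ∑ i ∈ S, b i := by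
  obtain ⟨⟨x, f⟩, ⟨hx, hf, -, hb, hfx⟩, rfl⟩ := hx
  dsimp only at hx hf hb hfx ⊢
  have hF : ∀ i j, 0 ≤ mat f i j := mat_nonneg hf
  have hFX : ∀ i j, mat f i j ≤ mat x i j := fun i j => by
    unfold mat; split_ifs <;> simp [hfx]
  set T : Finset N := S.map ⟨Subtype.val, Subtype.val_injective⟩ with hT
  have hsum : ∀ g : N → ℝ, ∑ i ∈ T, g i = ∑ i ∈ S, g i.1 := fun g => by simp [hT]
  have hin : ∑ i ∈ T, ∑ j ∈ T, mat x j i = ∑ i ∈ S, ∑ j ∈ S, subMat r x i j := by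
    rw [Finset.sum_comm]; simp only [hsum]; rfl
  have hbS : ∑ i ∈ T, (∑ j, mat f j i - ∑ j, mat f i j) = ∑ i ∈ S, b i := by
    rw [hsum]
    refine Finset.sum_congr rfl fun i _ => ?_
    have := hb i
    rw [sum_outArcs, sum_inArcs] at this
    linarith
  have hcut : ∑ i ∈ T, (∑ j, mat f j i - ∑ j, mat f i j)
      = ∑ i ∈ T, ∑ j ∈ Tᶜ, mat f j i - ∑ i ∈ T, ∑ j ∈ Tᶜ, mat f i j := by
    have h1 : ∑ i ∈ T, ∑ j ∈ T, mat f j i = ∑ i ∈ T, ∑ j ∈ T, mat f i j := Finset.sum_comm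
    simp only [← Finset.sum_add_sum_compl T, Finset.sum_sub_distrib, Finset.sum_add_distrib]
    linarith
  have hle : ∑ i ∈ T, ∑ j ∈ Tᶜ, mat f j i ≤ ∑ i ∈ T, ∑ j ∈ Tᶜ, mat x j i :=
    Finset.sum_le_sum fun i _ => Finset.sum_le_sum fun j _ => hFX j i
  have hout : 0 ≤ ∑ i ∈ T, ∑ j ∈ Tᶜ, mat f i j :=
    Finset.sum_nonneg fun i _ => Finset.sum_nonneg fun j _ => hF i j
  have hcol : ∑ i ∈ T, ∑ j ∈ T, mat x j i + ∑ i ∈ T, ∑ j ∈ Tᶜ, mat x j i = S.card := by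
    rw [← Finset.sum_add_distrib, Finset.sum_congr rfl fun i _ =>
      (Finset.sum_add_sum_compl T fun j => mat x j i).trans (col_sum hx i)]
    simp [hT]
  linarith

/-- Sending almost all of the flow to one node of `S` yields the subtour elimination inequality
for `S`. -/
theorem subtour_of_mem_Cl_projSCF {x : Arc N → ℝ} (hx : x ∈ Cl (projSCF r) (paramB r))
    {S : Finset (NonRoot r)} (hS : S.Nonempty) :
    ∑ i ∈ S, ∑ j ∈ S, subMat r x i j ≤ S.card - 1 := by
  obtain ⟨k, hk⟩ := hS
  have hpos : (0 : ℝ) < Fintype.card (NonRoot r) := by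
    exact_mod_cast Fintype.card_pos_iff.2 ⟨k⟩
  have key : ∀ t : ℝ, 0 < t → t < 1 →
      (1 - t) * 1 + t * (S.card * (Fintype.card (NonRoot r) : ℝ)⁻¹)
        ≤ S.card - ∑ i ∈ S, ∑ j ∈ S, subMat r x i j := by
    intro t ht ht'
    have hb : (fun i => (1 - t) * (if i = k then 1 else 0)
        + t * (Fintype.card (NonRoot r) : ℝ)⁻¹) ∈ paramB r := by
      constructor
      · intro i
        have : 0 ≤ (1 - t) * (if i = k then 1 else 0) :=
          mul_nonneg (by linarith) (by split_ifs <;> norm_num)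
        positivity
      · rw [Finset.sum_add_distrib, ← Finset.mul_sum]
        simp only [Finset.sum_ite_eq', Finset.mem_univ, if_true, Finset.sum_const,
          Finset.card_univ, nsmul_eq_mul]
        field_simp
        ring
    have := sum_within_le_of_mem_projSCF (mem_Cl.1 hx _ hb) S
    rw [Finset.sum_add_distrib, ← Finset.mul_sum] at this
    simp only [Finset.sum_ite_eq', hk, if_true, Finset.sum_const, nsmul_eq_mul] at this
    linarith
  linarith [le_of_forall_segment key]

theorem paramB_nonempty [Nonempty (NonRoot r)] : (paramB r).Nonempty := by
  refine ⟨fun _ => (Fintype.card (NonRoot r) : ℝ)⁻¹, fun i => ?_, ?_⟩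
  · have := Fintype.card_pos (α := NonRoot r)
    positivity
  · rw [Finset.sum_const, Finset.card_univ, nsmul_eq_mul, mul_inv_cancel₀]
    exact_mod_cast Fintype.card_ne_zero

theorem Cl_projSCF_subset [Nonempty (NonRoot r)] :
    Cl (projSCF r) (paramB r) ⊆ Cl (projDL r) (paramD r) := by
  intro x hx
  rw [mem_Cl_projDL_iff]
  obtain ⟨b, hb⟩ := paramB_nonempty (r := r)
  have hAP : x ∈ assignmentPolytope N := by
    obtain ⟨z, hz, rfl⟩ := mem_Cl.1 hx b hb
    exact hz.1
  exact ⟨hAP, fun ρ hρ d hd => DLIneq_of_subtour hρ (subMat_nonneg hAP)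
    (fun i => mat_self _ _) hd (subtour_of_mem_Cl_projSCF hx hρ.nonempty_support)⟩

end CycleInequalities

/-! ### Flows on four nodes -/

section FourNodes

/-- On four nodes, a flow of value one from the node `0` to the node `k`. It saturates the arcs
leaving `0` and the arcs entering `k`; what the two other nodes receive in excess is exchanged
between them. -/
noncomputable def unitFlow (X : Fin 4 → Fin 4 → ℝ) (k i j : Fin 4) : ℝ :=
  if j = 0 ∨ i = k ∨ i = j then 0 else if i = 0 ∨ j = k then X i j else max (X 0 i - X i k) 0

variable {X : Fin 4 → Fin 4 → ℝ}

theorem unitFlow_mem (h0 : ∀ i j, 0 ≤ X i j) (hd : ∀ i, X i i = 0)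
    (hr : ∀ i, ∑ j, X i j = 1) (hc : ∀ j, ∑ i, X i j = 1)
    (h2 : ∀ i j, i ≠ 0 → j ≠ 0 → i ≠ j → X i j + X j i ≤ 1) {k : Fin 4} (hk : k ≠ 0)
    (i j : Fin 4) : 0 ≤ unitFlow X k i j ∧ unitFlow X k i j ≤ X i j := by
  have r0 := hr 0; have r1 := hr 1; have r2 := hr 2; have r3 := hr 3
  have c0 := hc 0; have c1 := hc 1; have c2 := hc 2; have c3 := hc 3
  have e12 := h2 1 2 (by decide) (by decide) (by decide)
  have e13 := h2 1 3 (by decide) (by decide) (by decide)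
  have e23 := h2 2 3 (by decide) (by decide) (by decide)
  simp only [Fin.sum_univ_four, hd] at r0 r1 r2 r3 c0 c1 c2 c3
  have hij := h0 i j
  unfold unitFlow
  split_ifs with h h'
  · exact ⟨le_rfl, hij⟩
  · exact ⟨hij, le_rfl⟩
  · refine ⟨le_max_right _ _, max_le ?_ hij⟩
    push Not at h h'
    have := h0 0 1; have := h0 0 2; have := h0 0 3; have := h0 1 0; have := h0 2 0
    have := h0 3 0
    clear h0 hr hc h2
    fin_cases k <;> fin_cases i <;> fin_cases j <;> simp at hk h h' ⊢ <;> linarith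

theorem unitFlow_conservation (hd : ∀ i, X i i = 0)
    (hr : ∀ i, ∑ j, X i j = 1) (hc : ∀ j, ∑ i, X i j = 1) {k : Fin 4} (hk : k ≠ 0)
    (i : Fin 4) : ∑ j, unitFlow X k i j - ∑ j, unitFlow X k j i
      = (if i = 0 then 1 else 0) - (if i = k then 1 else 0) := by
  have r0 := hr 0
  have c1 := hc 1; have c2 := hc 2; have c3 := hc 3
  simp only [Fin.sum_univ_four, hd] at r0 c1 c2 c3
  fin_cases k <;> fin_cases i <;> simp [Fin.sum_univ_four, unitFlow] at hk ⊢ <;> grind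

theorem Cl_projMTZ_subset_of_four :
    Cl (projMTZ (0 : Fin 4)) (paramD 0) ⊆ Cl (projSCF (0 : Fin 4)) (paramB 0) := by
  intro x hx
  rw [mem_Cl_projMTZ_iff] at hx
  obtain ⟨hx, hcirc⟩ := hx
  have h0 : ∀ i j, 0 ≤ mat x i j := mat_nonneg fun a => (hx.1 a).1
  have h2 : ∀ i j : Fin 4, i ≠ 0 → j ≠ 0 → i ≠ j → mat x i j + mat x j i ≤ 1 := by
    intro i j hi hj hij
    have hne : (⟨i, hi⟩ : NonRoot (0 : Fin 4)) ≠ ⟨j, hj⟩ := fun h => hij (congrArg Subtype.val h)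
    have := hcirc _ (Equiv.Perm.isCycle_swap hne)
    rw [Equiv.Perm.support_swap hne, Finset.sum_pair hne, Finset.card_pair hne] at this
    simp only [Equiv.swap_apply_left, Equiv.swap_apply_right, subMat] at this
    push_cast at this
    linarith
  rw [mem_Cl]
  intro b hb
  set f : Arc (Fin 4) → ℝ :=
    fun a => ∑ k : NonRoot (0 : Fin 4), b k * unitFlow (mat x) k.1 a.tail a.head with hf
  have hmat : ∀ i j, mat f i j = ∑ k : NonRoot (0 : Fin 4), b k * unitFlow (mat x) k.1 i j := by
    intro i j
    by_cases h : i = j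
    · simp [h, unitFlow]
    · rw [mat_of_ne _ h]
  have hcons : ∀ i : Fin 4, ∑ a ∈ outArcs i, f a - ∑ a ∈ inArcs i, f a
      = ∑ k : NonRoot (0 : Fin 4),
        b k * ((if i = 0 then 1 else 0) - (if i = k.1 then 1 else 0)) := by
    intro i
    rw [sum_outArcs, sum_inArcs]
    simp only [hmat]
    rw [Finset.sum_comm, Finset.sum_comm (γ := Fin 4), ← Finset.sum_sub_distrib]
    refine Finset.sum_congr rfl fun k _ => ?_
    rw [← Finset.mul_sum, ← Finset.mul_sum, ← mul_sub,
      unitFlow_conservation (mat_self x) (row_sum hx) (col_sum hx) k.2]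
  have hmem : ∀ (k : NonRoot (0 : Fin 4)) i j, 0 ≤ unitFlow (mat x) k.1 i j ∧
      unitFlow (mat x) k.1 i j ≤ mat x i j := fun k i j =>
    unitFlow_mem h0 (mat_self x) (row_sum hx) (col_sum hx) h2 k.2 i j
  refine ⟨(x, f), ⟨hx, fun a => ?_, ?_, fun i => ?_, fun a => ?_⟩, rfl⟩
  · change 0 ≤ f a
    exact Finset.sum_nonneg fun k _ => mul_nonneg (hb.1 k).le (hmem k _ _).1
  · refine (hcons 0).trans ((Finset.sum_congr rfl fun k _ => ?_).trans hb.2)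
    simp [k.2.symm]
  · refine (hcons i.1).trans ?_
    rw [Finset.sum_eq_single i]
    · simp [i.2]
    · intro k _ hki
      simp [i.2, Subtype.val_injective.ne hki.symm]
    · simp
  · calc f a ≤ ∑ k : NonRoot (0 : Fin 4), b k * mat x a.tail a.head :=
          Finset.sum_le_sum fun k _ => mul_le_mul_of_nonneg_left (hmem k _ _).2 (hb.1 k).le
      _ = x a := by rw [← Finset.sum_mul, hb.2, one_mul, mat_tail_head]

end FourNodes

/-! ### Cycle covers with two cycles, and tours -/

section CycleCovers

theorem inv_mem_of_forall_mem {N : Type*} {π : Equiv.Perm N} {T : Finset N}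
    (h : ∀ i ∈ T, π i ∈ T) {i : N} (hi : i ∈ T) : π⁻¹ i ∈ T :=
  Equiv.Perm.perm_symm_on_of_perm_on_finset h hi

theorem mem_of_apply_mem {N : Type*} {π : Equiv.Perm N} {T : Finset N}
    (h : ∀ i ∈ T, π i ∈ T) {i : N} (hi : π i ∈ T) : i ∈ T := by
  simpa using inv_mem_of_forall_mem h hi

variable {N : Type*} {r : N} {S : Finset N} {σ : Equiv.Perm N}

/-- The permutation `σ` is a cycle cover of the nodes consisting of two cycles, one through the
nodes of the nonempty set `S` and one through all other nodes, among them `r`. This is expressed by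
saying that `S` is invariant and the only nonempty invariant set that does not contain `r`. -/
structure IsTwoCycleCover (r : N) (S : Finset N) (σ : Equiv.Perm N) : Prop where
  ne : ∀ i, σ i ≠ i
  root_notMem : r ∉ S
  mem : ∀ i ∈ S, σ i ∈ S
  eq_of_invariant : ∀ T : Finset N, r ∉ T → T.Nonempty → (∀ i ∈ T, σ i ∈ T) → T = S

/-- The permutation `τ` is a tour: no proper nonempty set of nodes is invariant. By passing to
complements it is enough to consider sets that do not contain `r`. -/
structure IsTour (r : N) (τ : Equiv.Perm N) : Prop where
  ne : ∀ i, τ i ≠ i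
  not_invariant : ∀ T : Finset N, r ∉ T → T.Nonempty → ¬ ∀ i ∈ T, τ i ∈ T

namespace IsTwoCycleCover

theorem inv (h : IsTwoCycleCover r S σ) : IsTwoCycleCover r S σ⁻¹ where
  ne i hi := h.ne i (by rw [Equiv.Perm.inv_eq_iff_eq] at hi; exact hi.symm)
  root_notMem := h.root_notMem
  mem i hi := inv_mem_of_forall_mem h.mem hi
  eq_of_invariant T hr hT hinv := h.eq_of_invariant T hr hT fun i hi => by
    simpa using inv_mem_of_forall_mem hinv hi

variable [DecidableEq N]

/-- Exchanging the successors of `r` and of a node of `S` joins the two cycles into a tour. -/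
theorem isTour (h : IsTwoCycleCover r S σ) {v : N} (hv : v ∈ S) :
    IsTour r (σ * Equiv.swap v r) := by
  have hvr : v ≠ r := fun e => h.root_notMem (e ▸ hv)
  have hother : ∀ i, i ≠ v → i ≠ r → (σ * Equiv.swap v r) i = σ i := fun i h1 h2 => by
    rw [Equiv.Perm.mul_apply, Equiv.swap_apply_of_ne_of_ne h1 h2]
  constructor
  · intro i
    by_cases h1 : i = v
    · subst h1
      rw [Equiv.Perm.mul_apply, Equiv.swap_apply_left]
      exact fun e => h.root_notMem (mem_of_apply_mem h.mem (e ▸ hv))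
    by_cases h2 : i = r
    · subst h2
      rw [Equiv.Perm.mul_apply, Equiv.swap_apply_right]
      exact fun e => h.root_notMem (e ▸ h.mem v hv)
    rw [hother i h1 h2]
    exact h.ne i
  · intro T hrT hT hinv
    by_cases hvT : v ∈ T
    · -- the part of `S` outside `T` is invariant under `σ`, and it does not contain `v`
      have hsub : S ⊆ T := by
        by_contra hns
        rw [← Finset.sdiff_nonempty] at hns
        have := h.eq_of_invariant (S \ T) (fun hr => h.root_notMem (Finset.mem_sdiff.1 hr).1) hns
          fun i hi => by
            rw [Finset.mem_sdiff] at hi ⊢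
            refine ⟨h.mem i hi.1, fun hiT => hi.2 ?_⟩
            rw [← hother i (fun e => hi.2 (e ▸ hvT)) (fun e => h.root_notMem (e ▸ hi.1))] at hiT
            exact mem_of_apply_mem hinv hiT
        rw [← this] at hv
        exact (Finset.mem_sdiff.1 hv).2 hvT
      refine hrT (mem_of_apply_mem hinv ?_)
      rw [Equiv.Perm.mul_apply, Equiv.swap_apply_right]
      exact hsub (h.mem v hv)
    · have := h.eq_of_invariant T hrT hT fun i hi => by
        rw [← hother i (fun e => hvT (e ▸ hi)) (fun e => hrT (e ▸ hi))]
        exact hinv i hi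
      exact hvT (this ▸ hv)

end IsTwoCycleCover

theorem mem_of_isCycle {V : Type*} [Fintype V] [DecidableEq V] {f : Equiv.Perm V}
    (hf : f.IsCycle) (P : V → Prop) (hP : ∀ i, P i → P (f i)) {i j : V} (hi : i ∈ f.support)
    (hj : j ∈ f.support) (h : P i) : P j := by
  obtain ⟨m, rfl⟩ := hf.exists_pow_eq (Equiv.Perm.mem_support.1 hi) (Equiv.Perm.mem_support.1 hj)
  clear hj
  induction m with
  | zero => simpa using h
  | succ m ih => rw [pow_succ', Equiv.Perm.mul_apply]; exact hP _ ih

variable [DecidableEq N]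

/-- The nodes of `N` that a permutation of the nodes other than `r` moves. -/
abbrev nodes [Fintype N] (ρ : Equiv.Perm (NonRoot r)) : Finset N :=
  ρ.support.map ⟨Subtype.val, Subtype.val_injective⟩

/-- A cycle that avoids `r` and some other node extends to a two-cycle cover of all nodes. -/
theorem exists_isTwoCycleCover [Fintype N] {ρ : Equiv.Perm (NonRoot r)} (hρ : ρ.IsCycle)
    (h2 : ρ.support.card + 2 ≤ Fintype.card N) :
    ∃ σ : Equiv.Perm N, IsTwoCycleCover r (nodes ρ) σ ∧ ∀ i ∈ ρ.support, σ i.1 = (ρ i).1 := by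
  set w : Equiv.Perm N := (nodes ρ)ᶜ.toList.formPerm with hw
  have hlen : 2 ≤ (nodes ρ)ᶜ.toList.length := by
    rw [Finset.length_toList, Finset.card_compl, Finset.card_map]; omega
  have hwsupp : w.support = (nodes ρ)ᶜ := by
    rw [hw, List.support_formPerm_of_nodup _ (Finset.nodup_toList _), Finset.toList_toFinset]
    intro x hx; rw [hx] at hlen; simp at hlen
  have hwc : w.IsCycle := List.isCycle_formPerm (Finset.nodup_toList _) hlen
  have hr : r ∉ nodes ρ := by simp
  have hmem : ∀ i : NonRoot r, i.1 ∈ nodes ρ ↔ i ∈ ρ.support := by simp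
  have hin : ∀ i ∈ ρ.support, (Equiv.Perm.ofSubtype ρ * w) i.1 = (ρ i).1 := by
    intro i hi
    rw [Equiv.Perm.mul_apply, (Equiv.Perm.notMem_support (f := w) (x := i.1)).1,
      Equiv.Perm.ofSubtype_apply_coe]
    rw [hwsupp, Finset.mem_compl, not_not, hmem]
    exact hi
  have hwout : ∀ i, i ∉ nodes ρ → w i ∉ nodes ρ := by
    intro i hi
    rw [← Finset.mem_compl, ← hwsupp] at hi ⊢
    exact Equiv.Perm.apply_mem_support.2 hi
  have hfix : ∀ i, i ∉ nodes ρ → Equiv.Perm.ofSubtype ρ i = i := by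
    intro i hi
    by_cases hir : i = r
    · exact Equiv.Perm.ofSubtype_apply_of_not_mem ρ (not_not.2 hir)
    · have := Equiv.Perm.ofSubtype_apply_coe ρ (⟨i, hir⟩ : NonRoot r)
      rw [Equiv.Perm.notMem_support.1 ((hmem ⟨i, hir⟩).not.1 hi)] at this
      exact this
  have hout : ∀ i, i ∉ nodes ρ → (Equiv.Perm.ofSubtype ρ * w) i = w i := by
    intro i hi
    rw [Equiv.Perm.mul_apply, hfix _ (hwout i hi)]
  refine ⟨Equiv.Perm.ofSubtype ρ * w, ⟨?_, hr, ?_, ?_⟩, hin⟩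
  · intro i
    by_cases hi : i ∈ nodes ρ
    · obtain ⟨j, hj, rfl⟩ := Finset.mem_map.1 hi
      exact (hin j hj).trans_ne (Subtype.val_injective.ne (Equiv.Perm.mem_support.1 hj))
    · rw [hout i hi]
      rw [← Finset.mem_compl, ← hwsupp] at hi
      exact Equiv.Perm.mem_support.1 hi
  · intro i hi
    obtain ⟨j, hj, rfl⟩ := Finset.mem_map.1 hi
    exact (hin j hj) ▸ (hmem _).2 (Equiv.Perm.apply_mem_support.2 hj)
  · intro T hrT hT hinv
    have hTsub : T ⊆ nodes ρ := by
      intro i hi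
      by_contra hin'
      have := mem_of_isCycle hwc (fun j => j ∈ T ∧ j ∉ nodes ρ)
        (fun j hj => ⟨hout j hj.2 ▸ hinv j hj.1, hwout j hj.2⟩) (i := i) (j := r)
        (by rwa [hwsupp, Finset.mem_compl]) (by rwa [hwsupp, Finset.mem_compl]) ⟨hi, hin'⟩
      exact hrT this.1
    refine hTsub.antisymm fun j hj => ?_
    obtain ⟨i, hi⟩ := hT
    obtain ⟨i', hi', rfl⟩ := Finset.mem_map.1 (hTsub hi)
    obtain ⟨j', hj', rfl⟩ := Finset.mem_map.1 hj
    exact (mem_of_isCycle hρ (fun j => j.1 ∈ T ∧ j ∈ ρ.support)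
      (fun j hj => ⟨hin j hj.2 ▸ hinv _ hj.1, Equiv.Perm.apply_mem_support.2 hj.2⟩) hi' hj'
      ⟨hi, hi'⟩).1

end CycleCovers

/-! ### Convex combinations of cycle covers -/

section Mixtures

variable {N : Type*} [DecidableEq N] {r : N} {ι : Type*} [Fintype ι]

/-- The combination, with weights `w`, of the incidence vectors of the cycle covers `π s`. -/
def mixture (w : ι → ℝ) (π : ι → Equiv.Perm N) (a : Arc N) : ℝ :=
  ∑ s, w s * if π s a.tail = a.head then 1 else 0

theorem mat_mixture {w : ι → ℝ} {π : ι → Equiv.Perm N} (hπ : ∀ s i, π s i ≠ i) (i j : N) :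
    mat (mixture w π) i j = ∑ s, w s * if π s i = j then 1 else 0 := by
  by_cases h : i = j
  · subst h; simp [hπ]
  · rw [mat_of_ne _ h]; rfl

/-- The number of arcs of the cycle cover `π` with both ends in `T`. -/
def arcCount (π : Equiv.Perm N) (T : Finset N) : ℝ := ∑ i ∈ T, if π i ∈ T then 1 else 0

theorem arcCount_le (π : Equiv.Perm N) (T : Finset N) : arcCount π T ≤ T.card := by
  have : ∑ i ∈ T, (1 : ℝ) = T.card := by simp
  rw [← this]
  exact Finset.sum_le_sum fun i _ => by split_ifs <;> simp

theorem arcCount_of_invariant {π : Equiv.Perm N} {T : Finset N} (h : ∀ i ∈ T, π i ∈ T) :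
    arcCount π T = T.card := by
  rw [arcCount, Finset.sum_congr rfl fun i hi => if_pos (h i hi)]; simp

theorem arcCount_le_sub_one {π : Equiv.Perm N} {T : Finset N} (h : ¬ ∀ i ∈ T, π i ∈ T) :
    arcCount π T ≤ T.card - 1 := by
  push Not at h
  obtain ⟨v, hv, hπv⟩ := h
  have hcard : ∑ i ∈ T.erase v, (1 : ℝ) = T.card - 1 := by
    rw [← Finset.card_erase_add_one hv]; simp
  rw [arcCount, ← Finset.add_sum_erase _ _ hv, if_neg hπv, zero_add, ← hcard]
  exact Finset.sum_le_sum fun i _ => by split_ifs <;> simp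

theorem sub_one_le_arcCount {π : Equiv.Perm N} {T : Finset N} {v : N} (hv : v ∈ T)
    (h : ∀ i ∈ T, i ≠ v → π i ∈ T) : (T.card : ℝ) - 1 ≤ arcCount π T := by
  have hcard : ∑ i ∈ T.erase v, (1 : ℝ) = T.card - 1 := by
    rw [← Finset.card_erase_add_one hv]; simp
  rw [arcCount, ← Finset.add_sum_erase _ _ hv, ← hcard]
  refine le_add_of_nonneg_of_le (by split_ifs <;> simp) (Finset.sum_le_sum fun i hi => ?_)
  rw [if_pos (h i (Finset.mem_of_mem_erase hi) (Finset.ne_of_mem_erase hi))]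

theorem sum_within_mixture {w : ι → ℝ} {π : ι → Equiv.Perm N} (hπ : ∀ s i, π s i ≠ i)
    (T : Finset (NonRoot r)) :
    ∑ i ∈ T, ∑ j ∈ T, subMat r (mixture w π) i j
      = ∑ s, w s * arcCount (π s) (T.map ⟨Subtype.val, Subtype.val_injective⟩) := by
  have h1 : ∑ i ∈ T, ∑ j ∈ T, subMat r (mixture w π) i j
      = ∑ i ∈ T.map ⟨Subtype.val, Subtype.val_injective⟩,
        ∑ j ∈ T.map ⟨Subtype.val, Subtype.val_injective⟩, mat (mixture w π) i j := by
    rw [Finset.sum_map]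
    refine Finset.sum_congr rfl fun i _ => ?_
    rw [Finset.sum_map]
    rfl
  rw [h1]
  simp only [mat_mixture hπ, arcCount]
  rw [Finset.sum_congr rfl fun i _ => Finset.sum_comm, Finset.sum_comm]
  refine Finset.sum_congr rfl fun s _ => ?_
  rw [Finset.mul_sum]
  refine Finset.sum_congr rfl fun i _ => ?_
  rw [← Finset.mul_sum, Finset.sum_ite_eq]

/-- A mixture of tours and of cycle covers that split the nodes into `S` and its complement
satisfies the subtour elimination inequalities for all node sets other than `S`. -/
theorem subtour_mixture {w : ι → ℝ} {π : ι → Equiv.Perm N} {S : Finset N}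
    (hπ : ∀ s, IsTwoCycleCover r S (π s) ∨ IsTour r (π s)) (hw : ∀ s, 0 ≤ w s)
    (hw1 : ∑ s, w s = 1) {T : Finset (NonRoot r)} (hT : T.Nonempty)
    (hTS : T.map ⟨Subtype.val, Subtype.val_injective⟩ ≠ S) :
    ∑ i ∈ T, ∑ j ∈ T, subMat r (mixture w π) i j ≤ T.card - 1 := by
  rw [sum_within_mixture fun s => (hπ s).elim (·.ne) (·.ne)]
  have hr : r ∉ T.map ⟨Subtype.val, Subtype.val_injective⟩ := by simp
  have hne : (T.map ⟨Subtype.val, Subtype.val_injective⟩).Nonempty := hT.map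
  have hle : ∀ s, arcCount (π s) (T.map ⟨Subtype.val, Subtype.val_injective⟩) ≤ T.card - 1 := by
    intro s
    rw [← Finset.card_map ⟨Subtype.val, Subtype.val_injective⟩]
    refine arcCount_le_sub_one fun hinv => ?_
    rcases hπ s with h | h
    · exact hTS (h.eq_of_invariant _ hr hne hinv)
    · exact h.not_invariant _ hr hne hinv
  calc _ ≤ ∑ s, w s * ((T.card : ℝ) - 1) :=
        Finset.sum_le_sum fun s _ => mul_le_mul_of_nonneg_left (hle s) (hw s)
    _ = T.card - 1 := by rw [← Finset.sum_mul, hw1, one_mul]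

variable [Fintype N]

theorem mixture_mem {w : ι → ℝ} {π : ι → Equiv.Perm N} (hπ : ∀ s i, π s i ≠ i)
    (hw : ∀ s, 0 ≤ w s) (hw1 : ∑ s, w s = 1) : mixture w π ∈ assignmentPolytope N := by
  refine ⟨fun a => ⟨Finset.sum_nonneg fun s _ => mul_nonneg (hw s) (by split_ifs <;> simp), ?_⟩,
    fun i => ?_, fun j => ?_⟩
  · rw [← hw1]
    exact Finset.sum_le_sum fun s _ =>
      mul_le_of_le_one_right (hw s) (by split_ifs <;> simp)
  · rw [sum_outArcs]
    simp only [mat_mixture hπ]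
    rw [Finset.sum_comm]
    simpa [← Finset.mul_sum] using hw1
  · rw [sum_inArcs]
    simp only [mat_mixture hπ]
    rw [Finset.sum_comm]
    simpa [← Finset.mul_sum, ← Equiv.Perm.eq_inv_iff_eq] using hw1

end Mixtures

/-! ### Mixtures of a two-cycle cover and related tours -/

theorem perm_inv_apply {V : Type*} (f : Equiv.Perm V) (i : V) : f⁻¹ (f i) = i :=
  f.symm_apply_apply i

theorem perm_apply_inv {V : Type*} (f : Equiv.Perm V) (i : V) : f (f⁻¹ i) = i :=
  f.apply_symm_apply i

section CyclesOnSameNodes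

variable {V : Type*} [Fintype V] [DecidableEq V]

/-- A cycle that at each of its nodes steps to a neighbour on another cycle with the same nodes is
that cycle or its reversal. -/
theorem eq_or_eq_inv {ρ ρ' : Equiv.Perm V} (hρ' : ρ'.IsCycle)
    (h3 : 3 ≤ ρ'.support.card) (hs : ρ'.support = ρ.support)
    (h : ∀ i ∈ ρ'.support, ρ' i = ρ i ∨ ρ' i = ρ⁻¹ i) : ρ' = ρ ∨ ρ' = ρ⁻¹ := by
  have hoff : ∀ i, i ∉ ρ'.support → ρ' i = ρ i ∧ ρ' i = ρ⁻¹ i := by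
    intro i hi
    have h1 := Equiv.Perm.notMem_support.1 hi
    rw [hs] at hi
    have h2 := Equiv.Perm.notMem_support.1 hi
    exact ⟨h1.trans h2.symm, h1.trans (by rw [Equiv.Perm.eq_inv_iff_eq, h2])⟩
  by_cases hex : ∃ i ∈ ρ'.support, ρ' i = ρ i
  · obtain ⟨i, hi, hii⟩ := hex
    left
    ext j
    by_cases hj : j ∈ ρ'.support
    · refine (mem_of_isCycle hρ' (fun j => j ∈ ρ'.support ∧ ρ' j = ρ j) ?_ hi hj ⟨hi, hii⟩).2
      rintro j ⟨hj, hjj⟩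
      have hj' := Equiv.Perm.apply_mem_support.2 hj
      refine ⟨hj', (h _ hj').resolve_right fun e => apply_apply_ne hρ' h3 hj ?_⟩
      rw [e, hjj, perm_inv_apply]
    · exact (hoff j hj).1
  · right
    push Not at hex
    ext j
    by_cases hj : j ∈ ρ'.support
    · exact (h j hj).resolve_left (hex j hj)
    · exact (hoff j hj).2

end CyclesOnSameNodes

section Pieces

variable {N : Type*} [DecidableEq N] {r : N} {S : Finset N} {σ π : Equiv.Perm N}

/-- The cycle covers that the mixtures below combine: a two-cycle cover `σ`, its reversal, and the
tours that arise from these two by exchanging the successors of `r` and of a node of `S`. -/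
def IsPiece (r : N) (S : Finset N) (σ π : Equiv.Perm N) : Prop :=
  (π = σ ∨ π = σ⁻¹) ∨ ∃ v ∈ S, π = σ * Equiv.swap v r ∨ π = σ⁻¹ * Equiv.swap v r

theorem IsPiece.cases (hσ : IsTwoCycleCover r S σ) (h : IsPiece r S σ π) :
    IsTwoCycleCover r S π ∨ IsTour r π := by
  rcases h with (rfl | rfl) | ⟨v, hv, rfl | rfl⟩
  · exact Or.inl hσ
  · exact Or.inl hσ.inv
  · exact Or.inr (hσ.isTour hv)
  · exact Or.inr (hσ.inv.isTour hv)

theorem IsTwoCycleCover.mul_swap_apply (hσ : IsTwoCycleCover r S σ) {v i : N} (hi : i ∈ S)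
    (h : i ≠ v) : (σ * Equiv.swap v r) i = σ i := by
  rw [Equiv.Perm.mul_apply,
    Equiv.swap_apply_of_ne_of_ne h fun e => hσ.root_notMem (by rwa [e] at hi)]

theorem IsTwoCycleCover.mul_swap_apply_notMem (hσ : IsTwoCycleCover r S σ) (v : N) :
    (σ * Equiv.swap v r) v ∉ S := by
  rw [Equiv.Perm.mul_apply, Equiv.swap_apply_left]
  exact fun h => hσ.root_notMem (mem_of_apply_mem hσ.mem h)

theorem IsPiece.apply (hσ : IsTwoCycleCover r S σ) (h : IsPiece r S σ π) {i : N} (hi : i ∈ S)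
    (hπ : π i ∈ S) : π i = σ i ∨ π i = σ⁻¹ i := by
  rcases h with (rfl | rfl) | ⟨v, hv, rfl | rfl⟩
  · exact Or.inl rfl
  · exact Or.inr rfl
  · exact Or.inl (hσ.mul_swap_apply hi (by rintro rfl; exact hσ.mul_swap_apply_notMem _ hπ))
  · exact Or.inr
      (hσ.inv.mul_swap_apply hi (by rintro rfl; exact hσ.inv.mul_swap_apply_notMem _ hπ))

theorem arcCount_mul_swap_le (hσ : IsTwoCycleCover r S σ) {v : N} (hv : v ∈ S) :
    arcCount (σ * Equiv.swap v r) S ≤ S.card - 1 :=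
  arcCount_le_sub_one fun h => hσ.mul_swap_apply_notMem v (h v hv)

theorem le_arcCount_mul_swap (hσ : IsTwoCycleCover r S σ) {v : N} (hv : v ∈ S) :
    (S.card : ℝ) - 1 ≤ arcCount (σ * Equiv.swap v r) S :=
  sub_one_le_arcCount hv fun i hi h => by rw [hσ.mul_swap_apply hi h]; exact hσ.mem i hi

variable {ι : Type*} [Fintype ι] {w : ι → ℝ} {πs : ι → Equiv.Perm N}

theorem subMat_mixture (hπ : ∀ s i, πs s i ≠ i) (i j : NonRoot r) :
    subMat r (mixture w πs) i j = ∑ s, w s * if πs s i.1 = j.1 then 1 else 0 :=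
  mat_mixture hπ _ _

theorem subMat_mixture_two {s t : ℝ} {τ : Equiv.Perm N} (hσ : ∀ i, σ i ≠ i)
    (hτ : ∀ i, τ i ≠ i) (i j : NonRoot r) :
    subMat r (mixture ![s, t] ![σ, τ]) i j
      = s * (if σ i.1 = j.1 then 1 else 0) + t * if τ i.1 = j.1 then 1 else 0 := by
  rw [subMat_mixture (Fin.forall_fin_two.2 ⟨hσ, hτ⟩), Fin.sum_univ_two]
  rfl

variable [Fintype N] {ρ : Equiv.Perm (NonRoot r)}

theorem inv_apply_eq (hρσ : ∀ i ∈ ρ.support, σ i.1 = (ρ i).1) {i : NonRoot r}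
    (hi : i ∈ ρ.support) : σ⁻¹ i.1 = (ρ⁻¹ i).1 := by
  rw [Equiv.Perm.inv_eq_iff_eq, hρσ _ (inv_mem_support hi), perm_apply_inv]

theorem mem_nodes {i : NonRoot r} (hi : i ∈ ρ.support) : i.1 ∈ nodes ρ :=
  Finset.mem_map_of_mem ⟨Subtype.val, Subtype.val_injective⟩ hi

theorem subMat_mixture_eq_zero (hσ : IsTwoCycleCover r (nodes ρ) σ)
    (hρσ : ∀ i ∈ ρ.support, σ i.1 = (ρ i).1) (hπ : ∀ s, IsPiece r (nodes ρ) σ (πs s))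
    {i j : NonRoot r} (hi : i ∈ ρ.support) (hj : j ∈ ρ.support) (h1 : j ≠ ρ i)
    (h2 : j ≠ ρ⁻¹ i) : subMat r (mixture w πs) i j = 0 := by
  rw [subMat_mixture fun s => ((hπ s).cases hσ).elim (·.ne) (·.ne)]
  refine Finset.sum_eq_zero fun s _ => ?_
  rw [if_neg, mul_zero]
  intro e
  rcases (hπ s).apply hσ (mem_nodes hi) (e ▸ mem_nodes hj) with e' | e'
  · exact h1 (Subtype.ext (e.symm.trans (e'.trans (hρσ i hi))))
  · exact h2 (Subtype.ext (e.symm.trans (e'.trans (inv_apply_eq hρσ hi))))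

theorem card_nodes : (nodes ρ).card = ρ.support.card := Finset.card_map _

theorem nodes_injective {T : Finset (NonRoot r)} (h : T ≠ ρ.support) :
    T.map ⟨Subtype.val, Subtype.val_injective⟩ ≠ nodes ρ :=
  fun e => h (Finset.map_injective _ e)

/-- For a mixture of pieces, the inequalities of the `d`-DL formulations need to be verified only
for the cycle of `ρ` and its reversal. All other node sets satisfy the subtour elimination
inequality, and any other cycle on the nodes of `ρ` contains a pair of nodes that no piece
joins. -/
theorem DLIneq_mixture (h3 : 3 ≤ ρ.support.card)
    (hσ : IsTwoCycleCover r (nodes ρ) σ) (hρσ : ∀ i ∈ ρ.support, σ i.1 = (ρ i).1)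
    (hπ : ∀ s, IsPiece r (nodes ρ) σ (πs s)) (hw : ∀ s, 0 ≤ w s) (hw1 : ∑ s, w s = 1)
    {d : Arc (NonRoot r) → ℝ} (hd : d ∈ closedParamD (NonRoot r))
    (h : ∀ ρ' : Equiv.Perm (NonRoot r), ρ' = ρ ∨ ρ' = ρ⁻¹ →
      DLIneq (subMat r (mixture w πs)) (mat d) ρ')
    {ρ' : Equiv.Perm (NonRoot r)} (hρ' : ρ'.IsCycle) :
    DLIneq (subMat r (mixture w πs)) (mat d) ρ' := by
  have hcases := fun s => (hπ s).cases hσ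
  have hx : mixture w πs ∈ assignmentPolytope N :=
    mixture_mem (fun s => (hcases s).elim (·.ne) (·.ne)) hw hw1
  have hX := subMat_nonneg (r := r) hx
  by_cases hs : ρ'.support = ρ.support
  · by_cases hall : ∀ i ∈ ρ'.support, ρ' i = ρ i ∨ ρ' i = ρ⁻¹ i
    · exact h ρ' (eq_or_eq_inv hρ' (hs ▸ h3) hs hall)
    push Not at hall
    obtain ⟨v, hv, hv1, hv2⟩ := hall
    have hv' := Equiv.Perm.apply_mem_support.2 hv
    refine DLIneq_of_sum_le hρ' hX hd ?_
    have hpair : ∀ i ∈ ρ'.support.erase v, subMat r (mixture w πs) i (ρ' i)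
        + subMat r (mixture w πs) (ρ' i) i ≤ 1 := by
      intro i hi
      have hne := (Equiv.Perm.mem_support.1 (Finset.mem_of_mem_erase hi)).symm
      have := subtour_mixture hcases hw hw1 (T := {i, ρ' i}) (by simp) (nodes_injective fun e => by
        rw [← e, Finset.card_pair hne] at h3; omega)
      rw [Finset.sum_pair hne, Finset.sum_pair hne, Finset.sum_pair hne,
        Finset.card_pair hne] at this
      simp only [subMat, mat_self] at this ⊢
      push_cast at this
      linarith
    have hzero : subMat r (mixture w πs) v (ρ' v) + subMat r (mixture w πs) (ρ' v) v = 0 := by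
      rw [hs] at hv hv'
      rw [subMat_mixture_eq_zero hσ hρσ hπ hv hv' hv1 hv2,
        subMat_mixture_eq_zero hσ hρσ hπ hv' hv, add_zero]
      · intro e; exact hv2 (by rw [Equiv.Perm.eq_inv_iff_eq]; exact e.symm)
      · intro e; exact hv1 (by rw [eq_comm, Equiv.Perm.inv_eq_iff_eq] at e; exact e)
    rw [← Finset.add_sum_erase _ _ hv, hzero, zero_add]
    refine (Finset.sum_le_sum hpair).trans_eq ?_
    rw [← Finset.card_erase_add_one hv]
    simp
  · exact DLIneq_of_subtour hρ' hX (fun i => mat_self _ _) hd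
      (subtour_mixture hcases hw hw1 hρ'.nonempty_support (nodes_injective hs))

end Pieces

/-! ### Points that separate the closures -/

section Points

variable {N : Type*} [DecidableEq N] [Fintype N] {r : N} {ρ : Equiv.Perm (NonRoot r)}
  {σ : Equiv.Perm N}

theorem tail_mem_support {a : Arc (NonRoot r)} (ha : a ∈ permArcs ρ) :
    a.head = ρ a.tail ∧ a.tail ∈ ρ.support := by
  have h : a.head = ρ a.tail := (Finset.mem_filter.1 ha).2
  exact ⟨h, Equiv.Perm.mem_support.2 fun e => a.2 (e.symm.trans h.symm)⟩

theorem eq_of_tail_eq {a b : Arc (NonRoot r)} (ha : a ∈ permArcs ρ) (hb : b ∈ permArcs ρ)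
    (h : a.tail = b.tail) : a = b :=
  Subtype.ext (Prod.ext h
    ((tail_mem_support ha).1.trans ((congrArg ρ h).trans (tail_mem_support hb).1.symm)))

theorem eq_of_head_eq {a b : Arc (NonRoot r)} (ha : a ∈ permArcs ρ) (hb : b ∈ permArcs ρ)
    (h : a.head = b.head) : a = b :=
  eq_of_tail_eq ha hb
    (ρ.injective ((tail_mem_support ha).1.symm.trans (h.trans (tail_mem_support hb).1)))

/-- The lower bounds on the arcs of a cycle and on all but one of the reversed arcs of the cycle
for a combination of `σ` and a tour obtained from `σ⁻¹`. -/
theorem mixture_pair_bounds {v : NonRoot r} (hv : v ∈ ρ.support)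
    (hσ : IsTwoCycleCover r (nodes ρ) σ) (hρσ : ∀ i ∈ ρ.support, σ i.1 = (ρ i).1) {s t : ℝ}
    (hs : 0 ≤ s) (ht : 0 ≤ t) {x : Arc N → ℝ}
    (hx : x = mixture ![s, t] ![σ, σ⁻¹ * Equiv.swap v.1 r]) :
    (∀ i ∈ ρ.support, s ≤ subMat r x i (ρ i)) ∧
      ∀ i ∈ ρ.support, ρ i ≠ v → t ≤ subMat r x (ρ i) i := by
  have hτ := (hσ.inv.isTour (mem_nodes hv)).ne
  subst hx
  constructor
  · intro i hi
    rw [subMat_mixture_two hσ.ne hτ, if_pos (hρσ i hi)]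
    split_ifs <;> linarith
  · intro i hi hiv
    have hi' := Equiv.Perm.apply_mem_support.2 hi
    have e : (σ⁻¹ * Equiv.swap v.1 r) (ρ i).1 = i.1 := by
      rw [hσ.inv.mul_swap_apply (mem_nodes hi') (Subtype.val_injective.ne hiv),
        inv_apply_eq hρσ hi', perm_inv_apply]
    rw [subMat_mixture_two hσ.ne hτ, if_pos e]
    split_ifs <;> linarith

/-- A point of the closure of the MTZ formulations with a large value on a cycle: two thirds of a
two-cycle cover through the cycle, one third of a tour through the reversed path. -/
theorem exists_mem_Cl_projMTZ (hρ : ρ.IsCycle) (h3 : 3 ≤ ρ.support.card)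
    (h2 : ρ.support.card + 2 ≤ Fintype.card N) {p q : Arc (NonRoot r)} (hp : p ∈ permArcs ρ)
    (hq : q ∈ permArcs ρ) (hpq : p.head = q.tail) :
    ∃ x ∈ Cl (projMTZ r) (paramD r), ((permArcs ρ).card : ℝ) - 1 <
      (∑ a ∈ permArcs ρ, (x a.incl + x a.rev.incl)) - x q.rev.incl - x p.rev.incl := by
  obtain ⟨σ, hσ, hρσ⟩ := exists_isTwoCycleCover hρ h2
  obtain ⟨hqh, hk⟩ := tail_mem_support hq
  set k := q.tail with hkdef
  set π : Fin 2 → Equiv.Perm N := ![σ, σ⁻¹ * Equiv.swap k.1 r] with hπdef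
  set x : Arc N → ℝ := mixture ![2 / 3, 1 / 3] π with hx
  have hw : ∀ s, 0 ≤ (![2 / 3, 1 / 3] : Fin 2 → ℝ) s := by
    rw [Fin.forall_fin_two]; norm_num
  have hw1 : ∑ s, (![2 / 3, 1 / 3] : Fin 2 → ℝ) s = 1 := by
    rw [Fin.sum_univ_two]; norm_num
  have hcases : ∀ s, IsTwoCycleCover r (nodes ρ) (π s) ∨ IsTour r (π s) := by
    rw [Fin.forall_fin_two]
    exact ⟨Or.inl hσ, Or.inr (hσ.inv.isTour (mem_nodes hk))⟩
  have hne := fun s => (hcases s).elim (·.ne) (·.ne)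
  have hAP : x ∈ assignmentPolytope N := mixture_mem hne hw hw1
  refine ⟨x, (mem_Cl_projMTZ_iff x).2 ⟨hAP, fun ρ' hρ' => ?_⟩, ?_⟩
  · by_cases hs : ρ'.support = ρ.support
    · -- `σ` and the tour have no common arc on the cycle
      have hle : ∀ i ∈ ρ'.support, subMat r x i (ρ' i) ≤ 2 / 3 := by
        intro i hi
        have hi' := Equiv.Perm.apply_mem_support.2 hi
        rw [hs] at hi hi'
        rw [hx, subMat_mixture_two hσ.ne (hσ.inv.isTour (mem_nodes hk)).ne]
        by_cases h1 : σ i.1 = (ρ' i).1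
        · rw [if_pos h1, if_neg, mul_zero, add_zero, mul_one]
          intro h
          by_cases hik : i = k
          · rw [hik] at h hi'
            exact hσ.inv.mul_swap_apply_notMem k.1 (h ▸ mem_nodes hi')
          · rw [hσ.inv.mul_swap_apply (mem_nodes hi) (Subtype.val_injective.ne hik), ← h1,
              inv_apply_eq hρσ hi, hρσ i hi] at h
            refine apply_apply_ne hρ h3 hi ?_
            rw [← Subtype.val_injective h, perm_apply_inv]
        · rw [if_neg h1]; split_ifs <;> norm_num
      have hcard : (3 : ℝ) ≤ ρ'.support.card := by rw [hs]; exact_mod_cast h3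
      have := Finset.sum_le_card_nsmul _ _ _ hle
      rw [nsmul_eq_mul] at this
      linarith
    · refine le_trans (Finset.sum_le_sum fun i hi => ?_)
        (subtour_mixture hcases hw hw1 hρ'.nonempty_support (nodes_injective hs))
      exact Finset.single_le_sum (f := fun j => subMat r x i j)
        (fun j _ => subMat_nonneg hAP i j) (Equiv.Perm.apply_mem_support.2 hi)
  · obtain ⟨hb1, hb2⟩ := mixture_pair_bounds hk hσ hρσ (s := 2 / 3) (t := 1 / 3) (by norm_num)
      (by norm_num) hx
    have hne' : q ≠ p := by
      rintro rfl
      exact q.2 (hpq.symm)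
    have hqp : q ∈ (permArcs ρ).erase p := Finset.mem_erase.2 ⟨hne', hq⟩
    have e1 : ((permArcs ρ).card : ℝ) * (2 / 3) ≤ ∑ a ∈ permArcs ρ, x a.incl := by
      rw [← nsmul_eq_mul]
      refine Finset.card_nsmul_le_sum _ _ _ fun a ha => ?_
      obtain ⟨h, h'⟩ := tail_mem_support ha
      rw [← subMat_incl x, h]
      exact hb1 _ h'
    have e2 : ((((permArcs ρ).erase p).erase q).card : ℝ) * (1 / 3)
        ≤ ∑ a ∈ ((permArcs ρ).erase p).erase q, x a.rev.incl := by
      rw [← nsmul_eq_mul]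
      refine Finset.card_nsmul_le_sum _ _ _ fun a ha => ?_
      simp only [Finset.mem_erase] at ha
      obtain ⟨h, h'⟩ := tail_mem_support ha.2.2
      rw [← subMat_rev_incl x, h]
      exact hb2 _ h' fun e => ha.2.1 (eq_of_head_eq ha.2.2 hp (h.trans (e.trans hpq.symm)))
    have c1 := Finset.card_erase_add_one hqp
    have c2 := Finset.card_erase_add_one hp
    have s1 := Finset.add_sum_erase _ (fun a : Arc (NonRoot r) => x a.rev.incl) hqp
    have s2 := Finset.add_sum_erase _ (fun a : Arc (NonRoot r) => x a.rev.incl) hp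
    rw [Finset.sum_add_distrib]
    have c3 : ((permArcs ρ).card : ℝ) = ((((permArcs ρ).erase p).erase q).card : ℝ) + 2 := by
      rw [← c2, ← c1]; push_cast; ring
    linarith

/-- A point of the closure of the `d`-DL formulations over the vectors `d^k` with a large value on
a cycle: one half of a two-cycle cover through the cycle and one half of a tour through the
reversed path. -/
theorem exists_mem_Cl_projDL_leaving (hρ : ρ.IsCycle) (h3 : 3 ≤ ρ.support.card)
    (h2 : ρ.support.card + 2 ≤ Fintype.card N) {q : Arc (NonRoot r)} (hq : q ∈ permArcs ρ) :
    ∃ x ∈ Cl (projDL r) (paramVMTZ r), ((permArcs ρ).card : ℝ) - 1 <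
      (∑ a ∈ permArcs ρ, (x a.incl + x a.rev.incl)) - x q.rev.incl := by
  obtain ⟨σ, hσ, hρσ⟩ := exists_isTwoCycleCover hρ h2
  obtain ⟨hqh, hqt⟩ := tail_mem_support hq
  have hk : q.head ∈ ρ.support := hqh ▸ Equiv.Perm.apply_mem_support.2 hqt
  have : Nonempty (NonRoot r) := ⟨q.head⟩
  set k := q.head with hkdef
  set π : Fin 2 → Equiv.Perm N := ![σ, σ⁻¹ * Equiv.swap k.1 r] with hπdef
  set x : Arc N → ℝ := mixture ![1 / 2, 1 / 2] π with hx
  have hw : ∀ s, 0 ≤ (![1 / 2, 1 / 2] : Fin 2 → ℝ) s := by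
    rw [Fin.forall_fin_two]; norm_num
  have hw1 : ∑ s, (![1 / 2, 1 / 2] : Fin 2 → ℝ) s = 1 := by
    rw [Fin.sum_univ_two]; norm_num
  have hpieces : ∀ s, IsPiece r (nodes ρ) σ (π s) := by
    rw [Fin.forall_fin_two]
    exact ⟨Or.inl (Or.inl rfl), Or.inr ⟨k.1, mem_nodes hk, Or.inr rfl⟩⟩
  have hne := fun s => ((hpieces s).cases hσ).elim (·.ne) (·.ne)
  have hAP : x ∈ assignmentPolytope N := mixture_mem hne hw hw1
  have hX := subMat_nonneg (r := r) hAP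
  obtain ⟨hb1, hb2⟩ := mixture_pair_bounds hk hσ hρσ (s := 1 / 2) (t := 1 / 2) (by norm_num)
    (by norm_num) hx
  refine ⟨x, (mem_Cl_projDL_leaving_iff x).2 ⟨hAP, fun ρ' hρ' l => ?_⟩, ?_⟩
  · refine DLIneq_mixture h3 hσ hρσ hpieces hw hw1 (leavingVector_mem_closedParamD l) ?_ hρ'
    clear! ρ'
    intro ρ' hρ'
    have hs : ρ'.support = ρ.support := by rcases hρ' with rfl | rfl <;> simp
    have hcyc : ρ'.IsCycle := by rcases hρ' with rfl | rfl; exacts [hρ, hρ.inv]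
    have hwithin := sum_cycle_le_within hcyc (hs ▸ h3) hX
    have htot : ∑ i ∈ ρ'.support, ∑ j ∈ ρ'.support, subMat r x i j
        ≤ ρ'.support.card - 1 / 2 := by
      rw [hs, hx, sum_within_mixture hne, Fin.sum_univ_two]
      have a1 := arcCount_le σ (nodes ρ)
      have a2 := arcCount_mul_swap_le hσ.inv (mem_nodes hk)
      rw [card_nodes] at a1 a2
      simp only [hπdef, Matrix.cons_val_zero, Matrix.cons_val_one]
      linarith
    unfold DLIneq
    rw [sum_leavingVector]
    set g : NonRoot r → ℝ := fun i =>
      (mat (leavingVector r l) i (ρ' i) + mat (leavingVector r l) (ρ' i) i) * subMat r x (ρ' i) i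
    have hL := mat_nonneg (leavingVector_mem_closedParamD l).1
    have hg : ∀ i ∈ ρ'.support, 0 ≤ g i := fun i _ =>
      mul_nonneg (add_nonneg (hL _ _) (hL _ _)) (hX _ _)
    split_ifs with hl
    · -- one of the two reversed arcs at the node `l` has value at least one half
      suffices h : ∃ i ∈ ρ'.support, 1 / 2 ≤ g i by
        obtain ⟨i, hi, hgi⟩ := h
        have := Finset.single_le_sum hg hi
        linarith
      have hg1 : ∀ i ∈ ρ'.support, (i = l ∨ ρ' i = l) → 1 / 2 ≤ subMat r x (ρ' i) i →
          1 / 2 ≤ g i := by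
        intro i hi hil h
        have hne := Equiv.Perm.mem_support.1 hi
        refine h.trans (le_mul_of_one_le_left (hX _ _) ?_)
        rw [mat_leavingVector l hne.symm, mat_leavingVector l hne]
        rcases hil with hil | hil <;> rw [if_pos hil] <;> split_ifs <;> norm_num
      rcases hρ' with rfl | rfl
      · by_cases hlk : l = k
        · exact ⟨l, hl, hg1 l hl (Or.inl rfl)
            (hb2 l hl fun e => Equiv.Perm.mem_support.1 hl (e.trans hlk.symm))⟩
        · refine ⟨ρ'⁻¹ l, inv_mem_support hl, hg1 _ (inv_mem_support hl) (Or.inr (by simp))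
            (hb2 _ (inv_mem_support hl) (by simpa using hlk))⟩
      · rw [hs] at hl
        refine ⟨l, by rwa [hs], hg1 l (by rwa [hs]) (Or.inl rfl) ?_⟩
        simpa using hb1 _ (inv_mem_support hl)
    · have := Finset.sum_nonneg hg
      linarith
  · have e1 : ((permArcs ρ).card : ℝ) * (1 / 2) ≤ ∑ a ∈ permArcs ρ, x a.incl := by
      rw [← nsmul_eq_mul]
      refine Finset.card_nsmul_le_sum _ _ _ fun a ha => ?_
      obtain ⟨h, h'⟩ := tail_mem_support ha
      rw [← subMat_incl x, h]
      exact hb1 _ h'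
    have e2 : (((permArcs ρ).erase q).card : ℝ) * (1 / 2)
        ≤ ∑ a ∈ (permArcs ρ).erase q, x a.rev.incl := by
      rw [← nsmul_eq_mul]
      refine Finset.card_nsmul_le_sum _ _ _ fun a ha => ?_
      rw [Finset.mem_erase] at ha
      obtain ⟨h, h'⟩ := tail_mem_support ha.2
      rw [← subMat_rev_incl x, h]
      exact hb2 _ h' fun e => ha.1 (eq_of_head_eq ha.2 hq (h.trans e))
    have c2 := Finset.card_erase_add_one hq
    have s2 := Finset.add_sum_erase _ (fun a : Arc (NonRoot r) => x a.rev.incl) hq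
    rw [Finset.sum_add_distrib]
    have c3 : ((permArcs ρ).card : ℝ) = (((permArcs ρ).erase q).card : ℝ) + 1 := by
      rw [← c2]; push_cast; ring
    linarith

theorem DLIneq_of_le_rev {X : NonRoot r → NonRoot r → ℝ} {d : Arc (NonRoot r) → ℝ}
    (hρ : ρ.IsCycle) (h3 : 3 ≤ ρ.support.card) (hX : ∀ i j, 0 ≤ X i j)
    (hd : d ∈ closedParamD (NonRoot r)) {c : ℝ} (hc : c ≤ 1)
    (hlow : ∀ i ∈ ρ.support, c ≤ X (ρ i) i)
    (h : ∑ i ∈ ρ.support, ∑ j ∈ ρ.support, X i j ≤ ρ.support.card - 1 + c) :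
    DLIneq X (mat d) ρ := by
  have h1 := sum_cycle_le_within hρ h3 hX
  have hD := mat_nonneg hd.1
  have h4 : c * ∑ i ∈ ρ.support, mat d i (ρ i)
      ≤ ∑ i ∈ ρ.support, (mat d i (ρ i) + mat d (ρ i) i) * X (ρ i) i := by
    rw [Finset.mul_sum]
    refine Finset.sum_le_sum fun i hi => ?_
    have := mul_le_mul_of_nonneg_left (hlow i hi) (hD i (ρ i))
    have := mul_nonneg (hD (ρ i) i) (hX (ρ i) i)
    linarith
  have h5 := mul_le_mul_of_nonneg_left (hd.2 ρ hρ) (sub_nonneg.2 hc)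
  unfold DLIneq
  linarith

/-- A point of the closure of the `d`-DL formulations that violates a subtour elimination
inequality: the average of a two-cycle cover, its reversal, and four tours. Two tours in each
direction are needed for every arc of the cycle, in either direction, to have value at least one
third. -/
theorem exists_mem_Cl_projDL (hρ : ρ.IsCycle) (h3 : 3 ≤ ρ.support.card)
    (h2 : ρ.support.card + 2 ≤ Fintype.card N) :
    ∃ x ∈ Cl (projDL r) (paramD r),
      (ρ.support.card : ℝ) - 1 < ∑ i ∈ ρ.support, ∑ j ∈ ρ.support, subMat r x i j := by
  obtain ⟨σ, hσ, hρσ⟩ := exists_isTwoCycleCover hρ h2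
  obtain ⟨u, hu, v, hv, huv⟩ := Finset.one_lt_card.1 (by omega : 1 < ρ.support.card)
  set π : Fin 6 → Equiv.Perm N := ![σ, σ⁻¹, σ * Equiv.swap u.1 r, σ * Equiv.swap v.1 r,
    σ⁻¹ * Equiv.swap u.1 r, σ⁻¹ * Equiv.swap v.1 r] with hπdef
  set x : Arc N → ℝ := mixture (fun _ => 1 / 6) π with hx
  have hw : ∀ s : Fin 6, (0 : ℝ) ≤ (fun _ => 1 / 6 : Fin 6 → ℝ) s := fun _ => by norm_num
  have hw1 : ∑ s : Fin 6, (fun _ => 1 / 6 : Fin 6 → ℝ) s = 1 := by simp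
  have hpieces : ∀ s, IsPiece r (nodes ρ) σ (π s) := by
    intro s
    fin_cases s
    · exact Or.inl (Or.inl rfl)
    · exact Or.inl (Or.inr rfl)
    · exact Or.inr ⟨u.1, mem_nodes hu, Or.inl rfl⟩
    · exact Or.inr ⟨v.1, mem_nodes hv, Or.inl rfl⟩
    · exact Or.inr ⟨u.1, mem_nodes hu, Or.inr rfl⟩
    · exact Or.inr ⟨v.1, mem_nodes hv, Or.inr rfl⟩
  have hne := fun s => ((hpieces s).cases hσ).elim (·.ne) (·.ne)
  have hAP : x ∈ assignmentPolytope N := mixture_mem hne hw hw1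
  have hX := subMat_nonneg (r := r) hAP
  have hsum : ∑ i ∈ ρ.support, ∑ j ∈ ρ.support, subMat r x i j = ρ.support.card - 2 / 3 := by
    have a1 := arcCount_of_invariant hσ.mem
    have a2 := arcCount_of_invariant hσ.inv.mem
    have b1 := arcCount_mul_swap_le hσ (mem_nodes hu)
    have b2 := arcCount_mul_swap_le hσ (mem_nodes hv)
    have b3 := arcCount_mul_swap_le hσ.inv (mem_nodes hu)
    have b4 := arcCount_mul_swap_le hσ.inv (mem_nodes hv)
    have c1 := le_arcCount_mul_swap hσ (mem_nodes hu)
    have c2 := le_arcCount_mul_swap hσ (mem_nodes hv)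
    have c3 := le_arcCount_mul_swap hσ.inv (mem_nodes hu)
    have c4 := le_arcCount_mul_swap hσ.inv (mem_nodes hv)
    rw [card_nodes] at a1 a2 b1 b2 b3 b4 c1 c2 c3 c4
    rw [hx, sum_within_mixture hne, Fin.sum_univ_six]
    change 1 / 6 * arcCount σ _ + 1 / 6 * arcCount σ⁻¹ _ + 1 / 6 * arcCount (σ * _) _
      + 1 / 6 * arcCount (σ * _) _ + 1 / 6 * arcCount (σ⁻¹ * _) _
      + 1 / 6 * arcCount (σ⁻¹ * _) _ = _
    linarith
  refine ⟨x, (mem_Cl_projDL_iff x).2 ⟨hAP, fun ρ' hρ' d hd => ?_⟩, by rw [hsum]; linarith⟩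
  -- each step of `σ` or `σ⁻¹` on the cycle is shared by at least one of two tours
  have hstep : ∀ (τ : Equiv.Perm N), IsTwoCycleCover r (nodes ρ) τ → ∀ i j : NonRoot r,
      i ∈ ρ.support → τ i.1 = j.1 →
      (1 : ℝ) ≤ (if (τ * Equiv.swap u.1 r) i.1 = j.1 then 1 else 0)
        + if (τ * Equiv.swap v.1 r) i.1 = j.1 then 1 else 0 := by
    intro τ hτ i j hi hij
    by_cases hiu : i = u
    · rw [if_pos ((hτ.mul_swap_apply (mem_nodes hi)
        (Subtype.val_injective.ne (hiu.trans_ne huv))).trans hij)]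
      split_ifs <;> norm_num
    · rw [if_pos ((hτ.mul_swap_apply (mem_nodes hi)
        (Subtype.val_injective.ne hiu)).trans hij)]
      split_ifs <;> norm_num
  have hentry : ∀ i j : NonRoot r, subMat r x i j =
      1 / 6 * (if σ i.1 = j.1 then 1 else 0) + 1 / 6 * (if σ⁻¹ i.1 = j.1 then 1 else 0)
      + 1 / 6 * (if (σ * Equiv.swap u.1 r) i.1 = j.1 then 1 else 0)
      + 1 / 6 * (if (σ * Equiv.swap v.1 r) i.1 = j.1 then 1 else 0)
      + 1 / 6 * (if (σ⁻¹ * Equiv.swap u.1 r) i.1 = j.1 then 1 else 0)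
      + 1 / 6 * (if (σ⁻¹ * Equiv.swap v.1 r) i.1 = j.1 then 1 else 0) := by
    intro i j
    rw [hx, subMat_mixture hne, Fin.sum_univ_six]
    rfl
  have hite : ∀ (τ : Equiv.Perm N) (i j : N), (0 : ℝ) ≤ if τ i = j then 1 else 0 :=
    fun τ i j => by split_ifs <;> norm_num
  refine DLIneq_mixture h3 hσ hρσ hpieces hw hw1 hd ?_ hρ'
  clear! ρ'
  intro ρ' hρ'
  have hs : ρ'.support = ρ.support := by rcases hρ' with rfl | rfl <;> simp
  have hcyc : ρ'.IsCycle := by rcases hρ' with rfl | rfl; exacts [hρ, hρ.inv]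
  refine DLIneq_of_le_rev hcyc (hs ▸ h3) hX hd (c := 1 / 3) (by norm_num) (fun i hi => ?_)
    (by rw [hs, hsum]; linarith)
  have hi' := Equiv.Perm.apply_mem_support.2 hi
  rw [hs] at hi hi'
  rw [hentry]
  have n1 := hite σ (ρ' i).1 i.1
  have n2 := hite σ⁻¹ (ρ' i).1 i.1
  have n3 := hite (σ * Equiv.swap u.1 r) (ρ' i).1 i.1
  have n4 := hite (σ * Equiv.swap v.1 r) (ρ' i).1 i.1
  have n5 := hite (σ⁻¹ * Equiv.swap u.1 r) (ρ' i).1 i.1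
  have n6 := hite (σ⁻¹ * Equiv.swap v.1 r) (ρ' i).1 i.1
  rcases hρ' with rfl | rfl
  · have e : σ⁻¹ (ρ' i).1 = i.1 := by rw [inv_apply_eq hρσ hi', perm_inv_apply]
    have := hstep _ hσ.inv _ i hi' e
    rw [if_pos e] at n2 ⊢
    linarith
  · have e : σ (ρ⁻¹ i).1 = i.1 := by rw [hρσ _ hi', perm_apply_inv]
    have := hstep _ hσ _ i hi' e
    rw [if_pos e] at n1 ⊢
    linarith

end Points

/-! ### Inequalities valid for the smaller closures -/

section Violation

theorem sum_support_eq_sum_permArcs {V : Type*} [Fintype V] [DecidableEq V] (ρ : Equiv.Perm V)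
    (G : V → V → ℝ) :
    ∑ i ∈ ρ.support, G i (ρ i) = ∑ a ∈ permArcs ρ, G a.tail a.head := by
  rw [sum_permArcs ρ fun a => G a.tail a.head]
  exact Finset.sum_congr rfl fun i hi =>
    (mat_of_ne (fun a => G a.tail a.head) (Equiv.Perm.mem_support.1 hi).symm).symm

variable {N : Type*} [Fintype N] [DecidableEq N] {r : N} {ρ : Equiv.Perm (NonRoot r)}

theorem DLIneq_iff_arcs (x : Arc N → ℝ) (d : Arc (NonRoot r) → ℝ) :
    DLIneq (subMat r x) (mat d) ρ ↔
      ∑ a ∈ permArcs ρ, (x a.incl + x a.rev.incl) + ∑ a ∈ permArcs ρ, d a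
        - ∑ a ∈ permArcs ρ, (d a + d a.rev) * x a.rev.incl ≤ (permArcs ρ).card := by
  rw [DLIneq, card_permArcs,
    sum_support_eq_sum_permArcs ρ fun i j => subMat r x i j + subMat r x j i,
    sum_support_eq_sum_permArcs ρ (mat d),
    sum_support_eq_sum_permArcs ρ fun i j => (mat d i j + mat d j i) * subMat r x j i]
  simp only [subMat_incl, subMat_rev_incl, mat_tail_head, mat_head_tail]

theorem le_of_mem_Cl_projDL_leaving [Nonempty (NonRoot r)] {x : Arc N → ℝ}
    (hx : x ∈ Cl (projDL r) (paramVMTZ r)) (hρ : ρ.IsCycle) {p q : Arc (NonRoot r)}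
    (hp : p ∈ permArcs ρ) (hq : q ∈ permArcs ρ) (hpq : p.head = q.tail) :
    (∑ a ∈ permArcs ρ, (x a.incl + x a.rev.incl)) - x q.rev.incl - x p.rev.incl
      ≤ (permArcs ρ).card - 1 := by
  have h := (DLIneq_iff_arcs x _).1 (((mem_Cl_projDL_leaving_iff x).1 hx).2 ρ hρ q.tail)
  have hd : ∀ a ∈ permArcs ρ, leavingVector r q.tail a = if a = q then 1 else 0 := by
    intro a ha
    exact if_congr ⟨eq_of_tail_eq ha hq, fun e => by rw [e]⟩ rfl rfl
  have hd' : ∀ a ∈ permArcs ρ, leavingVector r q.tail a.rev = if a = p then 1 else 0 := by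
    intro a ha
    exact if_congr ⟨fun e => eq_of_head_eq ha hp (Eq.trans e hpq.symm),
      fun e => by rw [e]; exact hpq⟩ rfl rfl
  have hsum : ∑ a ∈ permArcs ρ, (leavingVector r q.tail a + leavingVector r q.tail a.rev)
      * x a.rev.incl = x q.rev.incl + x p.rev.incl := by
    rw [Finset.sum_congr rfl fun a ha => by rw [hd a ha, hd' a ha]]
    simp [add_mul, Finset.sum_add_distrib, hp, hq]
  rw [Finset.sum_congr rfl hd, hsum, Finset.sum_ite_eq', if_pos hq] at h
  linarith

theorem le_of_mem_Cl_projDL {x : Arc N → ℝ} (hx : x ∈ Cl (projDL r) (paramD r))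
    (hρ : ρ.IsCycle) (h3 : 3 ≤ ρ.support.card) {q : Arc (NonRoot r)} (hq : q ∈ permArcs ρ) :
    (∑ a ∈ permArcs ρ, (x a.incl + x a.rev.incl)) - x q.rev.incl
      ≤ (permArcs ρ).card - 1 := by
  have h := (DLIneq_iff_arcs x _).1
    (((mem_Cl_projDL_iff x).1 hx).2 ρ hρ _ (single_mem_closedParamD q))
  -- the reversal of `q` is not an arc of the cycle, which has more than two arcs
  have hrev : ∀ a ∈ permArcs ρ, a.rev ≠ q := by
    rintro a ha rfl
    obtain ⟨h1, h2⟩ := tail_mem_support ha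
    exact apply_apply_ne hρ h3 h2 (by rw [← h1]; exact (tail_mem_support hq).1.symm)
  have hsum : ∑ a ∈ permArcs ρ, ((if a = q then 1 else 0) + if a.rev = q then 1 else 0)
      * x a.rev.incl = x q.rev.incl := by
    rw [Finset.sum_congr rfl fun a ha => by rw [if_neg (hrev a ha), add_zero]]
    simp [hq]
  rw [hsum, Finset.sum_ite_eq', if_pos hq] at h
  linarith

theorem exists_isCycle_support {V : Type*} [Fintype V] [DecidableEq V] {S : Finset V}
    (hS : 2 ≤ S.card) : ∃ ρ : Equiv.Perm V, ρ.IsCycle ∧ ρ.support = S := by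
  have hlen : 2 ≤ S.toList.length := by rwa [Finset.length_toList]
  refine ⟨S.toList.formPerm, List.isCycle_formPerm (Finset.nodup_toList _) hlen, ?_⟩
  rw [List.support_formPerm_of_nodup _ (Finset.nodup_toList _), Finset.toList_toFinset]
  intro x hx; rw [hx] at hlen; simp at hlen

theorem exists_mem_permArcs {ρ : Equiv.Perm (NonRoot r)} {i : NonRoot r} (hi : i ∈ ρ.support) :
    ∃ q ∈ permArcs ρ, q.tail = i :=
  ⟨⟨(i, ρ i), (Equiv.Perm.mem_support.1 hi).symm⟩, by simp [permArcs], rfl⟩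

end Violation

end ATSP

/-! ### The comparison of the closures -/

theorem mainTheorem4 (n : ℕ) [NeZero n] (hn : 4 ≤ n) :
    -- the nodes are the elements of `Fin n`, and `0` is the special node
    (ATSP.Cl (ATSP.projSCF (0 : Fin n)) (ATSP.paramB 0) ⊆
        ATSP.Cl (ATSP.projDL (0 : Fin n)) (ATSP.paramD 0) ∧
      ATSP.Cl (ATSP.projDL (0 : Fin n)) (ATSP.paramD 0) ⊆
        ATSP.Cl (ATSP.projDL (0 : Fin n)) (ATSP.paramVMTZ 0) ∧
      ATSP.Cl (ATSP.projDL (0 : Fin n)) (ATSP.paramVMTZ 0) ⊆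
        ATSP.Cl (ATSP.projMTZ (0 : Fin n)) (ATSP.paramD 0)) ∧
    (n = 4 →
      ATSP.Cl (ATSP.projSCF (0 : Fin n)) (ATSP.paramB 0) =
        ATSP.Cl (ATSP.projDL (0 : Fin n)) (ATSP.paramD 0) ∧
      ATSP.Cl (ATSP.projDL (0 : Fin n)) (ATSP.paramD 0) =
        ATSP.Cl (ATSP.projDL (0 : Fin n)) (ATSP.paramVMTZ 0) ∧
      ATSP.Cl (ATSP.projDL (0 : Fin n)) (ATSP.paramVMTZ 0) =
        ATSP.Cl (ATSP.projMTZ (0 : Fin n)) (ATSP.paramD 0)) ∧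
    (5 ≤ n →
      -- `p` and `q` are the arcs of the cycle `C` entering and leaving its node `k`
      (∀ C : Finset (ATSP.Arc (ATSP.NonRoot (0 : Fin n))), ATSP.IsDirectedCycle C →
        3 ≤ C.card → C.card ≤ n - 2 →
        ∀ k : ATSP.NonRoot (0 : Fin n), ∀ p ∈ C, ∀ q ∈ C, p.head = k → q.tail = k →
          ∃ x ∈ ATSP.Cl (ATSP.projMTZ (0 : Fin n)) (ATSP.paramD 0),
            (C.card : ℝ) - 1 <
              (∑ a ∈ C, (x a.incl + x a.rev.incl)) - x q.rev.incl - x p.rev.incl) ∧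
      ATSP.Cl (ATSP.projDL (0 : Fin n)) (ATSP.paramVMTZ 0) ⊂
        ATSP.Cl (ATSP.projMTZ (0 : Fin n)) (ATSP.paramD 0) ∧
      (∀ C : Finset (ATSP.Arc (ATSP.NonRoot (0 : Fin n))), ATSP.IsDirectedCycle C →
        3 ≤ C.card → C.card ≤ n - 2 →
        ∀ q ∈ C,
          ∃ x ∈ ATSP.Cl (ATSP.projDL (0 : Fin n)) (ATSP.paramVMTZ 0),
            (C.card : ℝ) - 1 < (∑ a ∈ C, (x a.incl + x a.rev.incl)) - x q.rev.incl) ∧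
      ATSP.Cl (ATSP.projDL (0 : Fin n)) (ATSP.paramD 0) ⊂
        ATSP.Cl (ATSP.projDL (0 : Fin n)) (ATSP.paramVMTZ 0) ∧
      (∀ S : Finset (ATSP.NonRoot (0 : Fin n)), 3 ≤ S.card → S.card ≤ n - 2 →
        ∃ x ∈ ATSP.Cl (ATSP.projDL (0 : Fin n)) (ATSP.paramD 0),
          (S.card : ℝ) - 1 < ∑ a ∈ ATSP.arcsWithin S, x a.incl) ∧
      ATSP.Cl (ATSP.projSCF (0 : Fin n)) (ATSP.paramB 0) ⊂
        ATSP.Cl (ATSP.projDL (0 : Fin n)) (ATSP.paramD 0)) := by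
  have : Nonempty (ATSP.NonRoot (0 : Fin n)) :=
    ⟨⟨⟨1, by omega⟩, fun h => by simpa using congrArg Fin.val h⟩⟩
  have hcard : Fintype.card (ATSP.NonRoot (0 : Fin n)) = n - 1 := by simp
  have s1 := ATSP.Cl_projSCF_subset (r := (0 : Fin n))
  have s2 := ATSP.Cl_projDL_subset (r := (0 : Fin n))
  have s3 := ATSP.Cl_projDL_leaving_subset (r := (0 : Fin n))
  refine ⟨⟨s1, s2, s3⟩, ?_, fun h5 => ?_⟩
  · rintro rfl
    have s4 := ATSP.Cl_projMTZ_subset_of_four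
    exact ⟨s1.antisymm (s2.trans (s3.trans s4)), s2.antisymm (s3.trans (s4.trans s1)),
      s3.antisymm (s4.trans (s1.trans s2))⟩
  -- a cycle with three arcs, on which all three strict inclusions are witnessed
  obtain ⟨S, -, hS⟩ := Finset.exists_subset_card_eq
    (s := (Finset.univ : Finset (ATSP.NonRoot (0 : Fin n)))) (n := 3)
    (by rw [Finset.card_univ, hcard]; omega)
  obtain ⟨ρ, hρ, rfl⟩ := ATSP.exists_isCycle_support (S := S) (by omega)
  obtain ⟨k, hk⟩ := hρ.nonempty_support
  obtain ⟨q, hq, hqk⟩ := ATSP.exists_mem_permArcs hk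
  obtain ⟨p, hp, hpk⟩ := ATSP.exists_mem_permArcs (ATSP.inv_mem_support hk)
  have hpq : p.head = q.tail := by
    rw [(ATSP.tail_mem_support hp).1, hpk, hqk, ATSP.perm_apply_inv]
  have h2 : ρ.support.card + 2 ≤ Fintype.card (Fin n) := by rw [Fintype.card_fin]; omega
  refine ⟨?_, ⟨s3, fun h => ?_⟩, ?_, ⟨s2, fun h => ?_⟩, ?_, ⟨s1, fun h => ?_⟩⟩
  · rintro C ⟨τ, hτ, rfl⟩ hC3 hCn k p hp q hq hpk hqk
    have hτc := ATSP.card_permArcs τ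
    exact ATSP.exists_mem_Cl_projMTZ hτ (hC3.trans_eq hτc)
      (by rw [← hτc, Fintype.card_fin]; exact (by omega : ∀ m, m ≤ n - 2 → m + 2 ≤ n) _ hCn)
      hp hq (hpk.trans hqk.symm)
  · obtain ⟨x, hx, hlt⟩ := ATSP.exists_mem_Cl_projMTZ hρ hS.ge h2 hp hq hpq
    exact absurd hlt (ATSP.le_of_mem_Cl_projDL_leaving (h hx) hρ hp hq hpq).not_gt
  · rintro C ⟨τ, hτ, rfl⟩ hC3 hCn q hq
    have hτc := ATSP.card_permArcs τ
    exact ATSP.exists_mem_Cl_projDL_leaving hτ (hC3.trans_eq hτc)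
      (by rw [← hτc, Fintype.card_fin]; exact (by omega : ∀ m, m ≤ n - 2 → m + 2 ≤ n) _ hCn) hq
  · obtain ⟨x, hx, hlt⟩ := ATSP.exists_mem_Cl_projDL_leaving hρ hS.ge h2 hq
    exact absurd hlt (ATSP.le_of_mem_Cl_projDL (h hx) hρ hS.ge hq).not_gt
  · intro T hT3 hTn
    obtain ⟨τ, hτ, rfl⟩ := ATSP.exists_isCycle_support (S := T) (by omega)
    obtain ⟨x, hx, hlt⟩ := ATSP.exists_mem_Cl_projDL hτ hT3 (by rw [Fintype.card_fin]; omega)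
    refine ⟨x, hx, ?_⟩
    rw [ATSP.sum_arcsWithin]
    simpa only [ATSP.mat_incl, ATSP.subMat] using hlt
  · obtain ⟨x, hx, hlt⟩ := ATSP.exists_mem_Cl_projDL hρ hS.ge h2
    exact absurd hlt (ATSP.subtour_of_mem_Cl_projSCF (h hx) hρ.nonempty_support).not_gt
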